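/- Let $n\ge 3$. For $\mathbf a=(\mathbf a_x,\mathbf a_z)\in\mathbb F_2^{2n}$ let $T_{\mathbf a}=\bigotimes_{i=1}^n i^{a_{ix}a_{iz}}X^{a_{ix}}Z^{a_{iz}}$ be the $n$-qubit Pauli operators, and for a pure state $|\psi\rangle$ put $c_\psi(\mathbf a)=2^{-n}\langle\psi|T_{\mathbf a}|\psi\rangle$. For $\alpha\in\{\tfrac12,1\}$, one round of direct fidelity estimation ($\alpha$-DFE) with target $\psi$ and input state $\rho$ samples $\mathbf a$ with probability $|c_\psi(\mathbf a)|^{2\alpha}/S$, where $S=\sum_{\mathbf b}|c_\psi(\mathbf b)|^{2\alpha}$, measures $\rho$ with the POVM $\{\tfrac12(1+(-1)^pT_{\mathbf a})\}_{p\in\mathbb F_2}$, and outputs $(-1)^p\,S\,|c_\psi(\mathbf a)|^{1-2\alpha}\,\mathrm{sgn}(c_\psi(\mathbf a))$. Let $\mathrm{Var}(\rho,\psi,\alpha)$ be the variance of this output and $\mathrm{Var}(\psi,\alpha)=\max_\rho\mathrm{Var}(\rho,\psi,\alpha)$, the maximum being over all $n$-qubit density matrices $\rho$. Let $N(n,r)$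 be the number of $n\times n$ symmetric matrices over $\mathbb F_2$ with zero diagonal and $\mathbb F_2$-rank $r$, and let $r(n,h)=N(n,2h)\,2^{-n(n-1)/2}$ be the fraction of such hollow symmetric matrices that have rank $2h$. Then for every integer $h\ge 0$ $$N(n,2h)=\prod_{i=1}^{h}\frac{2^{2i-2}}{2^{2i}-1}\cdot\prod_{i=0}^{2h-1}\left(2^{n-i}-1\right).$$ Let $\psi$ be the $n$-qubit complete third-order hypergraph state $$|\psi\rangle=2^{-n/2}\sum_{\mathbf x\in\mathbb F_2^n}(-1)^{\sum_{i<j<k}x_ix_jx_k}|\mathbf x\rangle .$$ Then, for $\alpha=1$ and also for $\alpha=\tfrac12$, the maximum $\mathrm{Var}(\psi,\alpha)$ exists and $$2^{\frac12\sum_{h=0}^{\lfloor n/2\rfloor}2h\,r(n,h)}\;\le\;\mathrm{Var}(\psi,\alpha)\;\le\;\sum_{h=0}^{\lfloor n/2\rfloor}r(n,h)\,2^{2h}.$$ Moreover, for every density matrix $\rho$ the quantity $\mathrm{Var}(\rho,\psi,\alpha)+\langle\psi|\rho|\psi\rangle^2$ satisfies the same two bounds. -/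

import Mathlib

open scoped ComplexOrder

/-! ### Pauli operators on `n` qubits

The computational basis of `n` qubits is indexed by the bit strings `Fin n → ZMod 2`; operators are
complex matrices and vectors are complex functions over this index set. -/

/-- The single-qubit operator `X : |y⟩ ↦ |y + 1⟩`. -/
def pauliX : Matrix (ZMod 2) (ZMod 2) ℂ := fun x y => if x = y + 1 then 1 else 0

/-- The single-qubit operator `Z : |y⟩ ↦ (-1)^y |y⟩`. -/
def pauliZ : Matrix (ZMod 2) (ZMod 2) ℂ := Matrix.diagonal fun y => (-1) ^ y.val

/-- The Hermitian Pauli operator `T_a = ⨂ᵢ i^(a_{ix} a_{iz}) X^(a_{ix}) Z^(a_{iz})`,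
for `a = (a_x, a_z)`. -/
def pauliT {n : ℕ} (a : (Fin n → ZMod 2) × (Fin n → ZMod 2)) :
    Matrix (Fin n → ZMod 2) (Fin n → ZMod 2) ℂ :=
  fun x y => ∏ i,
    (Complex.I ^ ((a.1 i).val * (a.2 i).val) •
      (pauliX ^ (a.1 i).val * pauliZ ^ (a.2 i).val)) (x i) (y i)

/-- The expectation `⟨ψ|A|ψ⟩` of an operator `A`; only used for Hermitian `A`, for which it is
real. -/
noncomputable def expval {n : ℕ} (ψ : (Fin n → ZMod 2) → ℂ)
    (A : Matrix (Fin n → ZMod 2) (Fin n → ZMod 2) ℂ) : ℝ :=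
  (star ψ ⬝ᵥ A.mulVec ψ).re

/-- The Pauli coefficient `c_ψ(a) = 2⁻ⁿ ⟨ψ|T_a|ψ⟩`. -/
noncomputable def pauliCoeff {n : ℕ} (ψ : (Fin n → ZMod 2) → ℂ)
    (a : (Fin n → ZMod 2) × (Fin n → ZMod 2)) : ℝ :=
  expval ψ (pauliT a) / 2 ^ n

/-- Density matrices of `n` qubits. -/
def IsDensityMatrix {n : ℕ} (ρ : Matrix (Fin n → ZMod 2) (Fin n → ZMod 2) ℂ) : Prop :=
  ρ.PosSemidef ∧ ρ.trace = 1

/-! ### Direct fidelity estimation -/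

/-- The projector `Π_a^p = (1 + (-1)^p T_a) / 2`. -/
noncomputable def pauliProj {n : ℕ} (a : (Fin n → ZMod 2) × (Fin n → ZMod 2)) (p : ZMod 2) :
    Matrix (Fin n → ZMod 2) (Fin n → ZMod 2) ℂ :=
  (1 / 2 : ℂ) • (1 + (-1 : ℂ) ^ p.val • pauliT a)

/-- The normalisation `∑_a |c_ψ(a)|^(2α)` of the `l_{2α}`-sampling distribution. -/
noncomputable def dfeNorm {n : ℕ} (α : ℝ) (ψ : (Fin n → ZMod 2) → ℂ) : ℝ :=
  ∑ a : (Fin n → ZMod 2) × (Fin n → ZMod 2), |pauliCoeff ψ a| ^ (2 * α)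

/-- The probability that one round of `α`-DFE with target `ψ` and input `ρ` samples `a` (from the
distribution proportional to `|c_ψ(a)|^(2α)`) and then, measuring the POVM `{Π_a^0, Π_a^1}` on `ρ`,
obtains the outcome `p` (with probability `tr (ρ Π_a^p)`). -/
noncomputable def dfeProb {n : ℕ} (α : ℝ) (ψ : (Fin n → ZMod 2) → ℂ)
    (ρ : Matrix (Fin n → ZMod 2) (Fin n → ZMod 2) ℂ)
    (ω : ((Fin n → ZMod 2) × (Fin n → ZMod 2)) × ZMod 2) : ℝ :=
  |pauliCoeff ψ ω.1| ^ (2 * α) / dfeNorm α ψ * (ρ * pauliProj ω.1 ω.2).trace.re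

/-- The value `(-1)^p (∑_b |c_ψ(b)|^(2α)) |c_ψ(a)|^(1-2α) sgn (c_ψ(a))` which `α`-DFE outputs after
sampling `a` and measuring `p`. Its value where `c_ψ(a) = 0` has probability zero. -/
noncomputable def dfeEstimator {n : ℕ} (α : ℝ) (ψ : (Fin n → ZMod 2) → ℂ)
    (ω : ((Fin n → ZMod 2) × (Fin n → ZMod 2)) × ZMod 2) : ℝ :=
  (-1) ^ ω.2.val * dfeNorm α ψ * |pauliCoeff ψ ω.1| ^ (1 - 2 * α) *
    Real.sign (pauliCoeff ψ ω.1)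

/-- The expected value of the one-round estimator. -/
noncomputable def dfeMean {n : ℕ} (α : ℝ) (ψ : (Fin n → ZMod 2) → ℂ)
    (ρ : Matrix (Fin n → ZMod 2) (Fin n → ZMod 2) ℂ) : ℝ :=
  ∑ ω, dfeProb α ψ ρ ω * dfeEstimator α ψ ω

/-- The estimation variance `Var(ρ, ψ, α)`: the variance of the one-round estimator. -/
noncomputable def dfeVariance {n : ℕ} (α : ℝ) (ψ : (Fin n → ZMod 2) → ℂ)
    (ρ : Matrix (Fin n → ZMod 2) (Fin n → ZMod 2) ℂ) : ℝ :=
  ∑ ω, dfeProb α ψ ρ ω * (dfeEstimator α ψ ω - dfeMean α ψ ρ) ^ 2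

/-! ### Hypergraph states -/

/-- The Boolean polynomial `P_G(x) = ∑_{A ∈ E} ∏_{i ∈ A} x_i` of the hypergraph `G = ([n], E)`. -/
def hypergraphPoly {n : ℕ} (E : Finset (Finset (Fin n))) (x : Fin n → ZMod 2) : ZMod 2 :=
  ∑ A ∈ E, ∏ i ∈ A, x i

/-- The hypergraph state `(∏_{A ∈ E} C_A Z) |+⟩^{⊗n} = 2^(-n/2) ∑_x (-1)^(P_G(x)) |x⟩`. -/
noncomputable def hypergraphState {n : ℕ} (E : Finset (Finset (Fin n))) :
    (Fin n → ZMod 2) → ℂ :=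
  fun x => (-1) ^ (hypergraphPoly E x).val / (Real.sqrt (2 ^ n) : ℂ)

/-- The complete third-order hypergraph state: its hyperedges are all the three-element sets of
qubits. -/
noncomputable def completeState3 (n : ℕ) : (Fin n → ZMod 2) → ℂ :=
  hypergraphState (Finset.powersetCard 3 (Finset.univ : Finset (Fin n)))

/-! ### Hollow symmetric binary matrices -/

/-- `N(n, r)`: the number of `n × n` symmetric matrices over `𝔽₂` with zero diagonal and of rank `r`
over `𝔽₂`. -/
noncomputable def hollowCount (n r : ℕ) : ℕ :=
  Set.ncard {A : Matrix (Fin n) (Fin n) (ZMod 2) | A.IsSymm ∧ (∀ i, A i i = 0) ∧ A.rank = r}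

/-- `r(n, h) = N(n, 2h) 2^(-n(n-1)/2)`: the fraction of rank `2h` among the `n × n` hollow symmetric
binary matrices. -/
noncomputable def hollowFrac (n h : ℕ) : ℝ :=
  (hollowCount n (2 * h) : ℝ) / 2 ^ (n * (n - 1) / 2)

/-! The estimator is unbiased for the fidelity, and its square depends on the sampled Pauli but not
on the outcome. Hence `Var(ρ,ψ,α) + ⟨ψ|ρ|ψ⟩²` is a constant, `dfeSecondMoment`, and the maximal
variance equals it, attained at a state orthogonal to `ψ` (`dfeVariance_add_sq`,
`isGreatest_dfeVariance`). Only this constant has to be bounded.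

For a state with phases `(-1)^f`, the Pauli coefficients with X-part `u` are, up to a phase and a
factor `4^n`, the Walsh transform of the derivative `D_u f`. If `f` is cubic, `D_u f` is quadratic
with some polar map `L_u`, so its squared Walsh values are `0` or `2^n |ker L_u|`, and Parseval
makes the nonzero value occur `2^n / |ker L_u| = 2^(rank L_u)` times. So the second moment is the
mean over `u` of `2^(rank L_u)` for `α = 1`, and the square of the mean of `2^(rank L_u / 2)` for `α
= 1/2`.

For the complete state, `f = e₁ e₂` modulo 2. The rank of `L_u` is `2⌊(n-1)/2⌋` for `u` of odd
weight and, for even weight, `0` if `u` is constant and `2` otherwise. With `x = 2^⌊(n-1)/2⌋` this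
gives closed forms in `x`.

The lower bound mostly uses only that the average rank is at most `2⌊n/2⌋`; the upper bound mostly
keeps the term of maximal rank, estimated through `hollowFrac_odd_ge`. The small cases `n = 4`
(lower) and `n = 3` (upper) are computed exactly. The formula for `N(n, 2h)` follows by adding one
row and column at a time. -/

/-! ### Counting hollow symmetric matrices by rank -/

lemma bits_add_self {ι : Type*} (v : ι → ZMod 2) : v + v = 0 :=
  funext fun i => CharTwo.add_self_eq_zero (v i)

lemma zmod_two_eq (a : ZMod 2) : a = 0 ∨ a = 1 := by
  revert a; decide

/-- The hollow symmetric matrices. -/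
def hollowSet (n : ℕ) : Set (Matrix (Fin n) (Fin n) (ZMod 2)) :=
  {A | A.IsSymm ∧ ∀ i, A i i = 0}

/-- The matrix `A` bordered by a first row and a first column `(0, b)`. -/
def border {n : ℕ} (A : Matrix (Fin n) (Fin n) (ZMod 2)) (b : Fin n → ZMod 2) :
    Matrix (Fin (n + 1)) (Fin (n + 1)) (ZMod 2) :=
  fun i j => Fin.cases (motive := fun _ => ZMod 2) (Fin.cases (motive := fun _ => ZMod 2) 0 b j)
    (fun i' => Fin.cases (motive := fun _ => ZMod 2) (b i') (A i') j) i

@[simp] lemma border_zero_zero {n : ℕ} (A : Matrix (Fin n) (Fin n) (ZMod 2)) (b) :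
    border A b 0 0 = 0 := rfl
@[simp] lemma border_zero_succ {n : ℕ} (A : Matrix (Fin n) (Fin n) (ZMod 2)) (b) (j : Fin n) :
    border A b 0 j.succ = b j := rfl
@[simp] lemma border_succ_zero {n : ℕ} (A : Matrix (Fin n) (Fin n) (ZMod 2)) (b) (i : Fin n) :
    border A b i.succ 0 = b i := rfl
@[simp] lemma border_succ_succ {n : ℕ} (A : Matrix (Fin n) (Fin n) (ZMod 2)) (b) (i j : Fin n) :
    border A b i.succ j.succ = A i j := rfl

lemma border_mem_hollowSet {n : ℕ} {A : Matrix (Fin n) (Fin n) (ZMod 2)} (hA : A ∈ hollowSet n)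
    (b : Fin n → ZMod 2) : border A b ∈ hollowSet (n + 1) := by
  refine ⟨Matrix.IsSymm.ext fun i j => ?_, fun i => ?_⟩
  · refine Fin.cases ?_ (fun i => ?_) i <;> refine Fin.cases ?_ (fun j => ?_) j <;>
      simp [hA.1.apply]
  · refine Fin.cases ?_ (fun i => ?_) i <;> simp [hA.2]

lemma border_injective {n : ℕ} :
    Function.Injective fun p : Matrix (Fin n) (Fin n) (ZMod 2) × (Fin n → ZMod 2) =>
      border p.1 p.2 := by
  rintro ⟨A, b⟩ ⟨A', b'⟩ h
  simp only at h
  ext i j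
  · simpa using congrFun (congrFun h i.succ) j.succ
  · simpa using congrFun (congrFun h i.succ) 0

lemma exists_border_eq {n : ℕ} {M : Matrix (Fin (n + 1)) (Fin (n + 1)) (ZMod 2)}
    (hM : M ∈ hollowSet (n + 1)) : ∃ A ∈ hollowSet n, ∃ b, border A b = M := by
  refine ⟨fun i j => M i.succ j.succ, ⟨?_, fun i => hM.2 _⟩, fun i => M i.succ 0, ?_⟩
  · exact Matrix.IsSymm.ext fun i j => hM.1.apply _ _
  · ext i j
    refine Fin.cases ?_ (fun i => ?_) i <;> refine Fin.cases ?_ (fun j => ?_) j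
    · exact (hM.2 0).symm
    · exact hM.1.apply _ _
    · rfl
    · rfl

lemma border_mulVec_cons {n : ℕ} (A : Matrix (Fin n) (Fin n) (ZMod 2)) (b y : Fin n → ZMod 2)
    (t : ZMod 2) :
    (border A b).mulVec (Fin.cons t y) = Fin.cons (b ⬝ᵥ y) (A.mulVec y + t • b) := by
  ext i
  refine Fin.cases ?_ (fun i => ?_) i <;>
    simp [Matrix.mulVec, dotProduct, Fin.sum_univ_succ]
  ring

/-- The form is alternating: the `(i, j)` and `(j, i)` terms cancel in characteristic 2, and the
diagonal terms vanish. -/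
lemma hollow_dotProduct_mulVec {n : ℕ} {A : Matrix (Fin n) (Fin n) (ZMod 2)}
    (hA : A ∈ hollowSet n) (y : Fin n → ZMod 2) : y ⬝ᵥ A.mulVec y = 0 := by
  have h2 : ∀ i j, y i * A i j * y j = y j * A j i * y i := fun i j => by
    rw [hA.1.apply]; ring
  simp only [dotProduct, Matrix.mulVec, Finset.mul_sum]
  rw [← Finset.sum_product']
  refine Finset.sum_involution (fun p _ => (p.2, p.1)) ?_ ?_ ?_ ?_
  · rintro ⟨i, j⟩ _
    simp only [← mul_assoc]
    rw [h2 i j]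
    exact CharTwo.add_self_eq_zero _
  · rintro ⟨i, j⟩ _ h he
    simp only [Prod.mk.injEq] at he
    obtain ⟨rfl, -⟩ := he
    simp [hA.2] at h
  · simp
  · simp

lemma symm_dotProduct_mulVec {n : ℕ} {A : Matrix (Fin n) (Fin n) (ZMod 2)}
    (hA : A ∈ hollowSet n) (x y : Fin n → ZMod 2) :
    x ⬝ᵥ A.mulVec y = A.mulVec x ⬝ᵥ y := by
  rw [Matrix.dotProduct_mulVec, ← Matrix.mulVec_transpose, hA.1]

lemma rank_add_finrank_ker {n : ℕ} (A : Matrix (Fin n) (Fin n) (ZMod 2)) :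
    A.rank + Module.finrank (ZMod 2) (LinearMap.ker A.mulVecLin) = n := by
  simpa [Matrix.rank] using LinearMap.finrank_range_add_finrank_ker A.mulVecLin

/-- If `b = A y₀`, the bordered kernel consists of the vectors `(t, k + t y₀)` with `k ∈ ker A`; the
equation from the first row is automatic because `A` is alternating. Nullity and size both grow by
one. -/
lemma rank_border_of_mem {n : ℕ} {A : Matrix (Fin n) (Fin n) (ZMod 2)} (hA : A ∈ hollowSet n)
    {b : Fin n → ZMod 2} (hb : b ∈ LinearMap.range A.mulVecLin) :
    (border A b).rank = A.rank := by
  obtain ⟨y₀, rfl⟩ := hb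
  simp only [Matrix.mulVecLin_apply]
  set b := A.mulVec y₀ with hb
  let φ : (LinearMap.ker A.mulVecLin) × ZMod 2 →ₗ[ZMod 2] (Fin (n + 1) → ZMod 2) :=
    { toFun := fun p => Fin.cons p.2 ((p.1 : Fin n → ZMod 2) + p.2 • y₀)
      map_add' := fun p q => by
        ext i; refine Fin.cases ?_ (fun i => ?_) i <;> simp; ring
      map_smul' := fun c p => by
        ext i; refine Fin.cases ?_ (fun i => ?_) i <;> simp; ring }
  have hinj : Function.Injective φ := by
    rw [← LinearMap.ker_eq_bot, LinearMap.ker_eq_bot']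
    rintro ⟨k, t⟩ h
    have h0 : t = 0 := congrFun h 0
    subst h0
    have h1 : ∀ i, (k : Fin n → ZMod 2) i = 0 := fun i => by
      simpa [φ] using congrFun h i.succ
    ext i
    · exact h1 i
    · rfl
  have hrange : LinearMap.range φ = LinearMap.ker (border A b).mulVecLin := by
    ext v
    simp only [LinearMap.mem_range, LinearMap.mem_ker, Matrix.mulVecLin_apply, Prod.exists]
    constructor
    · rintro ⟨⟨k, hk⟩, t, rfl⟩
      have hk' : A.mulVec k = 0 := by simpa using hk
      have : φ (⟨k, hk⟩, t) = Fin.cons t (k + t • y₀) := rfl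
      rw [this, border_mulVec_cons, Matrix.mulVec_add, Matrix.mulVec_smul, hk', ← hb,
        dotProduct_add, dotProduct_smul, dotProduct_comm b y₀, hollow_dotProduct_mulVec hA, hb,
        ← symm_dotProduct_mulVec hA, hk', zero_add, bits_add_self]
      ext i; refine Fin.cases ?_ (fun i => ?_) i <;> simp
    · intro h
      rw [← Fin.cons_self_tail v, border_mulVec_cons] at h
      have h1 : A.mulVec (Fin.tail v) + v 0 • b = 0 := by
        ext i; simpa using congrFun h i.succ
      refine ⟨⟨Fin.tail v + v 0 • y₀, ?_⟩, v 0, ?_⟩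
      · simp [Matrix.mulVec_add, Matrix.mulVec_smul, ← hb, h1]
      · ext i
        refine Fin.cases ?_ (fun i => ?_) i
        · rfl
        · simp [φ, Fin.tail, add_assoc, CharTwo.add_self_eq_zero]
  have h1 := rank_add_finrank_ker A
  have h2 := rank_add_finrank_ker (border A b)
  rw [← hrange, LinearMap.finrank_range_of_inj hinj] at h2
  simp only [Module.finrank_prod, Module.finrank_self] at h2
  omega

/-- Since `b` is outside the range, the first kernel coordinate must be 0, leaving the `k ∈ ker A`
with `b ⬝ᵥ k = 0`. This is a proper hyperplane of `ker A`, as the range of a symmetric `A` is the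
orthogonal complement of its kernel. The nullity drops by one while the size grows by one. -/
lemma rank_border_of_notMem {n : ℕ} {A : Matrix (Fin n) (Fin n) (ZMod 2)} (hA : A ∈ hollowSet n)
    {b : Fin n → ZMod 2} (hb : b ∉ LinearMap.range A.mulVecLin) :
    (border A b).rank = A.rank + 2 := by
  let g : LinearMap.ker A.mulVecLin →ₗ[ZMod 2] ZMod 2 :=
    { toFun := fun k => b ⬝ᵥ (k : Fin n → ZMod 2)
      map_add' := fun x y => by simp
      map_smul' := fun c x => by simp }
  have hg : g ≠ 0 := by
    obtain ⟨f, hfb, hf⟩ := Submodule.exists_le_ker_of_notMem hb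
    obtain ⟨k, hk⟩ : ∃ k : Fin n → ZMod 2, ∀ x, f x = k ⬝ᵥ x :=
      ⟨fun i => f (Pi.single i 1), fun x => by
        conv_lhs => rw [pi_eq_sum_univ' x]
        simp [dotProduct, mul_comm, map_sum]⟩
    have hkA : A.mulVec k = 0 := by
      ext i
      have : f (A.mulVec (Pi.single i 1)) = 0 := hf ⟨Pi.single i 1, rfl⟩
      rw [hk, symm_dotProduct_mulVec hA] at this
      simpa using this
    intro h0
    apply hfb
    have := LinearMap.congr_fun h0 ⟨k, by simpa using hkA⟩
    rw [hk, dotProduct_comm]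
    exact this
  have hker := Module.Dual.finrank_ker_add_one_of_ne_zero hg
  let φ : LinearMap.ker g →ₗ[ZMod 2] (Fin (n + 1) → ZMod 2) :=
    { toFun := fun k => Fin.cons 0 (k.1.1)
      map_add' := fun p q => by
        ext i; refine Fin.cases ?_ (fun i => ?_) i <;> simp
      map_smul' := fun c p => by
        ext i; refine Fin.cases ?_ (fun i => ?_) i <;> simp }
  have hinj : Function.Injective φ := by
    intro k k' h
    ext i
    simpa [φ] using congrFun h i.succ
  have hrange : LinearMap.range φ = LinearMap.ker (border A b).mulVecLin := by
    ext v
    simp only [LinearMap.mem_range, LinearMap.mem_ker, Matrix.mulVecLin_apply]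
    constructor
    · rintro ⟨⟨⟨k, hk⟩, hgk⟩, rfl⟩
      have hk' : A.mulVec k = 0 := by simpa using hk
      have hgk' : b ⬝ᵥ k = 0 := hgk
      change (border A b).mulVec (Fin.cons 0 k) = 0
      rw [border_mulVec_cons, hk', hgk']
      ext i; refine Fin.cases ?_ (fun i => ?_) i <;> simp
    · intro h
      rw [← Fin.cons_self_tail v, border_mulVec_cons] at h
      have h1 : A.mulVec (Fin.tail v) + v 0 • b = 0 := by
        ext i; simpa using congrFun h i.succ
      have h2 : b ⬝ᵥ Fin.tail v = 0 := congrFun h 0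
      have h0 : v 0 = 0 := by
        rcases zmod_two_eq (v 0) with h | h
        · exact h
        · rw [h, one_smul] at h1
          refine absurd ⟨Fin.tail v, ?_⟩ hb
          rw [Matrix.mulVecLin_apply, ← add_zero (A.mulVec _), ← bits_add_self b, ← add_assoc, h1,
            zero_add]
      rw [h0, zero_smul, add_zero] at h1
      refine ⟨⟨⟨Fin.tail v, by simpa using h1⟩, h2⟩, ?_⟩
      change Fin.cons 0 (Fin.tail v) = v
      rw [← h0, Fin.cons_self_tail]
  have h1 := rank_add_finrank_ker A
  have h2 := rank_add_finrank_ker (border A b)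
  rw [← hrange, LinearMap.finrank_range_of_inj hinj] at h2
  omega

open Classical in
/-- The hollow symmetric matrices as a finset. -/
noncomputable def hollowFinset (n : ℕ) : Finset (Matrix (Fin n) (Fin n) (ZMod 2)) :=
  Finset.univ.filter fun A => A ∈ hollowSet n

lemma mem_hollowFinset {n : ℕ} {A : Matrix (Fin n) (Fin n) (ZMod 2)} :
    A ∈ hollowFinset n ↔ A ∈ hollowSet n := by
  simp [hollowFinset]

lemma hollowCount_eq_card (n r : ℕ) :
    hollowCount n r = ((hollowFinset n).filter fun A => A.rank = r).card := by
  rw [hollowCount, ← Set.ncard_coe_finset]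
  congr 1
  ext A
  simp [mem_hollowFinset, hollowSet, and_assoc]

lemma sum_hollowFinset_succ {n : ℕ} (F : Matrix (Fin (n + 1)) (Fin (n + 1)) (ZMod 2) → ℕ) :
    ∑ M ∈ hollowFinset (n + 1), F M =
      ∑ A ∈ hollowFinset n, ∑ b : Fin n → ZMod 2, F (border A b) := by
  rw [← Finset.sum_product']
  symm
  refine Finset.sum_bij (fun p _ => border p.1 p.2) ?_ ?_ ?_ ?_
  · rintro ⟨A, b⟩ h
    simp only [Finset.mem_product, mem_hollowFinset] at h ⊢
    exact border_mem_hollowSet h.1 b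
  · intro p _ q _ h
    exact border_injective h
  · intro M hM
    obtain ⟨A, hA, b, rfl⟩ := exists_border_eq (mem_hollowFinset.mp hM)
    exact ⟨(A, b), by simp [mem_hollowFinset, hA], rfl⟩
  · intros; rfl

lemma card_hollowFinset (n : ℕ) : (hollowFinset n).card = 2 ^ (n * (n - 1) / 2) := by
  rw [← Finset.sum_range_id]
  induction n with
  | zero =>
    have : hollowFinset 0 = Finset.univ := by
      ext A
      simp only [mem_hollowFinset, Finset.mem_univ, iff_true]
      exact ⟨Matrix.IsSymm.ext fun i => i.elim0, fun i => i.elim0⟩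
    rw [this]
    simp [Fintype.card_eq_one_iff_nonempty_unique]
    exact ⟨⟨⟨0⟩, fun A => Matrix.ext fun i => i.elim0⟩⟩
  | succ n ih =>
    rw [Finset.card_eq_sum_ones, sum_hollowFinset_succ, Finset.sum_range_succ, pow_add, ← ih]
    simp

lemma card_range_mulVecLin {n : ℕ} (A : Matrix (Fin n) (Fin n) (ZMod 2))
    [DecidablePred (· ∈ LinearMap.range A.mulVecLin)] :
    (Finset.univ.filter fun b => b ∈ LinearMap.range A.mulVecLin).card = 2 ^ A.rank := by
  have h := Module.natCard_eq_pow_finrank (K := ZMod 2) (V := LinearMap.range A.mulVecLin)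
  rw [Nat.card_zmod] at h
  rw [Matrix.rank, ← h, Nat.card_eq_fintype_card, Fintype.card_subtype]

lemma sum_rank_border {n : ℕ} {A : Matrix (Fin n) (Fin n) (ZMod 2)} (hA : A ∈ hollowSet n)
    (r : ℕ) :
    (∑ b : Fin n → ZMod 2, if (border A b).rank = r then 1 else 0) =
      (if A.rank = r then 2 ^ r else 0) + if A.rank + 2 = r then 2 ^ n - 2 ^ A.rank else 0 := by
  classical
  rw [← Finset.sum_filter_add_sum_filter_not _ (fun b => b ∈ LinearMap.range A.mulVecLin)]
  have hc := Finset.card_filter_add_card_filter_not (s := (Finset.univ : Finset (Fin n → ZMod 2)))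
    (fun b => b ∈ LinearMap.range A.mulVecLin)
  rw [card_range_mulVecLin] at hc
  simp only [Finset.card_univ, Fintype.card_pi, ZMod.card, Finset.prod_const, Fintype.card_fin]
    at hc
  congr 1
  · rw [Finset.sum_congr rfl (g := fun _ => if A.rank = r then 1 else 0), Finset.sum_const,
      card_range_mulVecLin]
    · split_ifs with h <;> simp [h]
    · intro b hb
      rw [rank_border_of_mem hA (Finset.mem_filter.mp hb).2]
  · rw [Finset.sum_congr rfl (g := fun _ => if A.rank + 2 = r then 1 else 0), Finset.sum_const]
    · split_ifs with h
      · simp only [smul_eq_mul, mul_one]; omega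
      · simp
    · intro b hb
      rw [rank_border_of_notMem hA (Finset.mem_filter.mp hb).2]

lemma hollowCount_succ_zero (n : ℕ) : hollowCount (n + 1) 0 = hollowCount n 0 := by
  rw [hollowCount_eq_card, hollowCount_eq_card, Finset.card_filter, Finset.card_filter,
    sum_hollowFinset_succ]
  refine Finset.sum_congr rfl fun A hA => ?_
  rw [sum_rank_border (mem_hollowFinset.mp hA)]
  simp

lemma hollowCount_succ_add_two (n r : ℕ) :
    hollowCount (n + 1) (r + 2) =
      2 ^ (r + 2) * hollowCount n (r + 2) + (2 ^ n - 2 ^ r) * hollowCount n r := by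
  rw [hollowCount_eq_card, hollowCount_eq_card, hollowCount_eq_card, Finset.card_filter,
    Finset.card_filter, Finset.card_filter, sum_hollowFinset_succ, Finset.mul_sum, Finset.mul_sum,
    ← Finset.sum_add_distrib]
  refine Finset.sum_congr rfl fun A hA => ?_
  rw [sum_rank_border (mem_hollowFinset.mp hA)]
  by_cases h : A.rank = r <;> simp [h]

lemma hollowCount_zero (n : ℕ) : hollowCount n 0 = 1 := by
  induction n with
  | zero =>
    have h : (hollowFinset 0).filter (fun A => A.rank = 0) = hollowFinset 0 :=
      Finset.filter_true_of_mem fun A _ => Nat.le_zero.mp (by simpa using A.rank_le_width)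
    rw [hollowCount_eq_card, h, card_hollowFinset]
    simp
  | succ n ih => rw [hollowCount_succ_zero, ih]

lemma hollowCount_eq_zero_of_lt {n r : ℕ} (h : n < r) : hollowCount n r = 0 := by
  rw [hollowCount_eq_card, Finset.card_eq_zero, Finset.filter_eq_empty_iff]
  intro A _ hr
  have := A.rank_le_width
  omega

/-- The closed form for the number of hollow symmetric matrices of rank `2 * h`. -/
noncomputable def hollowFormula (n h : ℕ) : ℝ :=
  (∏ i ∈ Finset.Icc 1 h, (2 : ℝ) ^ (2 * i - 2) / (2 ^ (2 * i) - 1)) *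
    ∏ i ∈ Finset.range (2 * h), ((2 : ℝ) ^ ((n : ℤ) - (i : ℤ)) - 1)

lemma prod_range_succ_shift (n k : ℕ) :
    ∏ i ∈ Finset.range (k + 1), ((2 : ℝ) ^ (((n + 1 : ℕ) : ℤ) - (i : ℤ)) - 1) =
      (∏ i ∈ Finset.range k, ((2 : ℝ) ^ ((n : ℤ) - (i : ℤ)) - 1)) * (2 ^ (n + 1) - 1) := by
  rw [Finset.prod_range_succ']
  congr 1
  · refine Finset.prod_congr rfl fun i _ => ?_
    congr 2
    push_cast; ring

/-- The closed form obeys the recursion of `hollowCount_succ_add_two`. After the common products `c`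
and `P` are split off, only a rational identity in `2^(2h)` and `2^n` remains. -/
lemma hollowFormula_succ (n h : ℕ) :
    hollowFormula (n + 1) (h + 1) =
      2 ^ (2 * h + 2) * hollowFormula n (h + 1) +
        ((2 : ℝ) ^ n - 2 ^ (2 * h)) * hollowFormula n h := by
  have hpos : (2 : ℝ) ^ (2 * (h + 1)) - 1 ≠ 0 := by
    have : (1 : ℝ) < 2 ^ (2 * (h + 1)) := one_lt_pow₀ (by norm_num) (by omega)
    linarith
  have h1 : (2 : ℝ) ^ ((n : ℤ) - ((2 * h : ℕ) : ℤ)) = 2 ^ n / 2 ^ (2 * h) := by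
    rw [zpow_sub₀ (by norm_num), zpow_natCast, zpow_natCast]
  have h2 : (2 : ℝ) ^ ((n : ℤ) - ((2 * h + 1 : ℕ) : ℤ)) = 2 ^ n / 2 ^ (2 * h + 1) := by
    rw [zpow_sub₀ (by norm_num), zpow_natCast, zpow_natCast]
  unfold hollowFormula
  rw [Finset.prod_Icc_succ_top (by omega), show 2 * (h + 1) = 2 * h + 1 + 1 by ring,
    prod_range_succ_shift, Finset.prod_range_succ _ (2 * h + 1), Finset.prod_range_succ _ (2 * h), h1, h2]
  rw [show 2 * (h + 1) = 2 * h + 2 by ring] at hpos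
  rw [show 2 * h + 1 + 1 - 2 = 2 * h by omega, show 2 * h + 1 + 1 = 2 * h + 2 by ring]
  generalize (∏ i ∈ Finset.Icc 1 h, (2 : ℝ) ^ (2 * i - 2) / (2 ^ (2 * i) - 1)) = c
  generalize (∏ i ∈ Finset.range (2 * h), ((2 : ℝ) ^ ((n : ℤ) - (i : ℤ)) - 1)) = P
  rw [pow_add _ (2 * h) 2, pow_add _ (2 * h) 1, pow_succ _ n] at *
  have hx : (2 : ℝ) ^ (2 * h) ≠ 0 := by positivity
  generalize (2 : ℝ) ^ (2 * h) = x at *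
  generalize (2 : ℝ) ^ n = y at *
  field_simp
  ring

lemma hollowCount_eq_hollowFormula (n h : ℕ) :
    (hollowCount n (2 * h) : ℝ) = hollowFormula n h := by
  induction n generalizing h with
  | zero =>
    rcases h with _ | h
    · simp [hollowCount_zero, hollowFormula]
    · rw [hollowCount_eq_zero_of_lt (by omega), hollowFormula,
        Finset.prod_eq_zero (i := 0) (s := Finset.range _) (by simp) (by simp)]
      simp
  | succ n ih =>
    rcases h with _ | h
    · simp [hollowCount_zero, hollowFormula]
    · rw [hollowFormula_succ, ← ih, ← ih, mul_add, mul_one, hollowCount_succ_add_two]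
      push_cast
      congr 1
      -- The natural subtraction `2^n - 2^(2h)` truncates when `n < 2h`, but the count it multiplies
      -- is then zero.
      rcases le_or_gt (2 * h) n with hle | hlt
      · rw [Nat.cast_sub (Nat.pow_le_pow_right (by norm_num) hle)]
        push_cast
        ring
      · rw [hollowCount_eq_zero_of_lt hlt]
        simp

/-! ### Characters, Pauli coefficients and Walsh transforms -/

/-- The nontrivial additive character of `ZMod 2`. -/
def chi (a : ZMod 2) : ℝ := (-1) ^ a.val

@[simp] lemma chi_zero : chi 0 = 1 := by simp [chi]

@[simp] lemma chi_one : chi 1 = -1 := by simp [chi, ZMod.val_one]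

lemma chi_add (a b : ZMod 2) : chi (a + b) = chi a * chi b := by
  rcases zmod_two_eq a with rfl | rfl <;> rcases zmod_two_eq b with rfl | rfl <;> simp
  rw [CharTwo.add_self_eq_zero, chi_zero]

lemma chi_mul_self (a : ZMod 2) : chi a * chi a = 1 := by
  rw [← chi_add, CharTwo.add_self_eq_zero, chi_zero]

lemma chi_eq (a : ZMod 2) : chi a = 1 ∨ chi a = -1 := by
  rcases zmod_two_eq a with rfl | rfl <;> simp

lemma chi_sum {ι : Type*} (s : Finset ι) (g : ι → ZMod 2) :
    chi (∑ i ∈ s, g i) = ∏ i ∈ s, chi (g i) := by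
  classical
  induction s using Finset.induction_on with
  | empty => simp
  | insert i s hi ih => rw [Finset.sum_insert hi, Finset.prod_insert hi, chi_add, ih]

lemma sum_chi_dotProduct {n : ℕ} (w : Fin n → ZMod 2) :
    ∑ d, chi (w ⬝ᵥ d) = if w = 0 then 2 ^ n else 0 := by
  split_ifs with h
  · simp [h]
  · obtain ⟨j, hj⟩ : ∃ j, w j ≠ 0 := by
      by_contra! hw
      exact h (funext hw)
    have hj1 : w j = 1 := (zmod_two_eq _).resolve_left hj
    -- Shifting `d` by the basis vector at `j` flips every sign, so the sum is its own negative.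
    have := Equiv.sum_comp (Equiv.addRight (Pi.single j (1 : ZMod 2))) fun d => chi (w ⬝ᵥ d)
    simp only [Equiv.coe_addRight, dotProduct_add, dotProduct_single, hj1, mul_one, chi_add,
      chi_one, mul_neg, Finset.sum_neg_distrib] at this
    linarith

/-- The number of factors `Y` of a Pauli operator. -/
def yCount {n : ℕ} (u z : Fin n → ZMod 2) : ℕ := ∑ i, (u i).val * (z i).val

lemma chi_dotProduct_eq {n : ℕ} (u z : Fin n → ZMod 2) : chi (u ⬝ᵥ z) = (-1) ^ yCount u z := by
  rw [dotProduct, chi_sum, yCount, ← Finset.prod_pow_eq_pow_sum]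
  refine Finset.prod_congr rfl fun i _ => ?_
  rcases zmod_two_eq (u i) with h | h <;> rcases zmod_two_eq (z i) with h' | h' <;>
    simp [h, h', ZMod.val_one]

lemma pauli_factor_apply (a b p q : ZMod 2) :
    (Complex.I ^ (a.val * b.val) • (pauliX ^ a.val * pauliZ ^ b.val)) p q =
      if p = q + a then Complex.I ^ (a.val * b.val) * (chi (b * q) : ℂ) else 0 := by
  rcases zmod_two_eq a with rfl | rfl <;> rcases zmod_two_eq b with rfl | rfl <;>
    simp [pauliX, pauliZ, ZMod.val_one, Matrix.one_apply, Matrix.diagonal_apply, chi]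
  split_ifs <;> simp_all

lemma pauliT_apply {n : ℕ} (u z x y : Fin n → ZMod 2) :
    pauliT (u, z) x y =
      if x = y + u then Complex.I ^ yCount u z * (chi (z ⬝ᵥ y) : ℂ) else 0 := by
  simp only [pauliT, pauli_factor_apply]
  split_ifs with h
  · subst h
    rw [Finset.prod_congr rfl (fun i _ => if_pos (Pi.add_apply y u i)), Finset.prod_mul_distrib,
      Finset.prod_pow_eq_pow_sum, dotProduct, chi_sum]
    push_cast
    rfl
  · obtain ⟨i, hi⟩ : ∃ i, x i ≠ y i + u i := by
      by_contra! hx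
      exact h (funext hx)
    exact Finset.prod_eq_zero (Finset.mem_univ i) (if_neg hi)

/-- The state `2^(-n/2) ∑_x (-1)^(f x) |x⟩`. -/
noncomputable def phaseState {n : ℕ} (f : (Fin n → ZMod 2) → ZMod 2) : (Fin n → ZMod 2) → ℂ :=
  fun x => ((chi (f x) / √(2 ^ n) : ℝ) : ℂ)

lemma hypergraphState_eq_phaseState {n : ℕ} (E : Finset (Finset (Fin n))) :
    hypergraphState E = phaseState (hypergraphPoly E) := by
  ext x
  simp [hypergraphState, phaseState, chi]

/-- The Walsh transform of the derivative of `f` in the direction `u`. -/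
noncomputable def walsh {n : ℕ} (f : (Fin n → ZMod 2) → ZMod 2) (u z : Fin n → ZMod 2) : ℝ :=
  ∑ y, chi (f y + f (y + u) + z ⬝ᵥ y)

lemma add_add_cancel_bits {n : ℕ} (y u : Fin n → ZMod 2) : y + u + u = y := by
  rw [add_assoc, bits_add_self, add_zero]

/-- The derivative of `f` along `u` is invariant under `y ↦ y + u`, so this substitution only
produces the factor `chi (u ⬝ᵥ z)`. In particular the transform vanishes when the number of `Y`
factors is odd. -/
lemma chi_mul_walsh {n : ℕ} (f : (Fin n → ZMod 2) → ZMod 2) (u z : Fin n → ZMod 2) :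
    chi (u ⬝ᵥ z) * walsh f u z = walsh f u z := by
  conv_rhs => rw [walsh, ← Equiv.sum_comp (Equiv.addRight u)]
  rw [walsh, Finset.mul_sum]
  refine Finset.sum_congr rfl fun y _ => ?_
  rw [← chi_add, Equiv.coe_addRight, add_add_cancel_bits, dotProduct_add, dotProduct_comm u z]
  congr 1
  ring

lemma sqrt_two_pow_mul_self (n : ℕ) : √((2 : ℝ) ^ n) * √(2 ^ n) = 2 ^ n :=
  Real.mul_self_sqrt (by positivity)

lemma phaseState_mul {n : ℕ} (f g : (Fin n → ZMod 2) → ZMod 2) (x y : Fin n → ZMod 2) :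
    phaseState f x * phaseState g y = ((chi (f x + g y) / 2 ^ n : ℝ) : ℂ) := by
  rw [phaseState, phaseState, ← Complex.ofReal_mul, div_mul_div_comm, sqrt_two_pow_mul_self,
    chi_add]

lemma star_phaseState {n : ℕ} (f : (Fin n → ZMod 2) → ZMod 2) :
    star (phaseState f) = phaseState f := by
  ext x
  simp [phaseState]

lemma star_dotProduct_pauliT_mulVec {n : ℕ} (f : (Fin n → ZMod 2) → ZMod 2)
    (u z : Fin n → ZMod 2) :
    star (phaseState f) ⬝ᵥ (pauliT (u, z)).mulVec (phaseState f) =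
      Complex.I ^ yCount u z * ((walsh f u z / 2 ^ n : ℝ) : ℂ) := by
  rw [star_phaseState]
  simp only [dotProduct, Matrix.mulVec, Finset.mul_sum]
  rw [Finset.sum_comm, walsh, Finset.sum_div, Complex.ofReal_sum, Finset.mul_sum]
  refine Finset.sum_congr rfl fun y _ => ?_
  rw [Finset.sum_eq_single (y + u)]
  · rw [pauliT_apply, if_pos rfl, mul_comm, mul_assoc, mul_comm _ (phaseState f (y + u)),
      phaseState_mul]
    simp only [chi_add]
    push_cast
    ring
  · intro x _ hx
    rw [pauliT_apply, if_neg hx]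
    simp
  · simp

/-- The real part in `expval` loses nothing: for an even number of `Y` factors the power of `I` is a
sign, and for an odd number `chi_mul_walsh` forces the transform to be zero. -/
lemma ofReal_pauliCoeff {n : ℕ} (f : (Fin n → ZMod 2) → ZMod 2) (u z : Fin n → ZMod 2) :
    (pauliCoeff (phaseState f) (u, z) : ℂ) =
      Complex.I ^ yCount u z * ((walsh f u z / 4 ^ n : ℝ) : ℂ) := by
  have h4 : (4 : ℝ) ^ n = 2 ^ n * 2 ^ n := by rw [← mul_pow]; norm_num
  rw [pauliCoeff, expval, star_dotProduct_pauliT_mulVec]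
  have hw := chi_mul_walsh f u z
  rw [chi_dotProduct_eq] at hw
  rcases Nat.even_or_odd' (yCount u z) with ⟨k, hk | hk⟩
  · have : Complex.I ^ yCount u z = (((-1) ^ k : ℝ) : ℂ) := by
      rw [hk, pow_mul, Complex.I_sq]; push_cast; rfl
    rw [this, ← Complex.ofReal_mul, ← Complex.ofReal_mul, Complex.ofReal_re, h4]
    congr 1
    field_simp
  · have h0 : walsh f u z = 0 := by
      rw [hk, pow_succ, pow_mul] at hw
      norm_num at hw
      linarith
    simp [h0]

lemma abs_pauliCoeff {n : ℕ} (f : (Fin n → ZMod 2) → ZMod 2) (u z : Fin n → ZMod 2) :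
    |pauliCoeff (phaseState f) (u, z)| = |walsh f u z| / 4 ^ n := by
  have h := congrArg norm (ofReal_pauliCoeff f u z)
  rw [Complex.norm_real, norm_mul, norm_pow, Complex.norm_I, one_pow, one_mul, Complex.norm_real,
    Real.norm_eq_abs, Real.norm_eq_abs, abs_div, abs_of_pos (by positivity : (0 : ℝ) < 4 ^ n)] at h
  exact h

lemma sum_walsh_mul_chi {n : ℕ} (f : (Fin n → ZMod 2) → ZMod 2) (u y : Fin n → ZMod 2) :
    ∑ z, walsh f u z * chi (z ⬝ᵥ y) = 2 ^ n * chi (f y + f (y + u)) := by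
  simp only [walsh, Finset.sum_mul]
  rw [Finset.sum_comm, Finset.sum_eq_single y]
  · simp only [chi_add _ (_ ⬝ᵥ _), mul_assoc, chi_mul_self]
    simp
  · intro x _ hx
    have : ∀ z, chi (f x + f (x + u) + z ⬝ᵥ x) * chi (z ⬝ᵥ y) =
        chi (f x + f (x + u)) * chi ((x + y) ⬝ᵥ z) := fun z => by
      rw [chi_add _ (_ ⬝ᵥ _), mul_assoc, ← chi_add, ← dotProduct_add, dotProduct_comm]
    simp only [this]
    rw [← Finset.mul_sum, sum_chi_dotProduct, if_neg, mul_zero]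
    intro h
    apply hx
    rw [← add_add_cancel_bits x y, h, zero_add]
  · simp

/-- Parseval for the `±1`-valued function `(-1)^(D_u f)`. -/
lemma sum_walsh_sq {n : ℕ} (f : (Fin n → ZMod 2) → ZMod 2) (u : Fin n → ZMod 2) :
    ∑ z, walsh f u z ^ 2 = 4 ^ n := by
  have : ∀ z, walsh f u z ^ 2 = ∑ y, chi (f y + f (y + u)) * (walsh f u z * chi (z ⬝ᵥ y)) :=
    fun z => by
      rw [sq]
      nth_rewrite 2 [walsh]
      rw [Finset.mul_sum]
      refine Finset.sum_congr rfl fun y _ => ?_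
      rw [chi_add _ (_ ⬝ᵥ _)]
      ring
  simp only [this]
  rw [Finset.sum_comm]
  simp only [← Finset.mul_sum, sum_walsh_mul_chi, mul_left_comm _ ((2 : ℝ) ^ n), chi_mul_self]
  simp only [mul_one, Finset.sum_const, Finset.card_univ, Fintype.card_pi, ZMod.card,
    Finset.prod_const, Fintype.card_fin, nsmul_eq_mul]
  push_cast
  rw [← mul_pow]
  norm_num

lemma pauliCoeff_eq_zero_iff {n : ℕ} (f : (Fin n → ZMod 2) → ZMod 2) (u z : Fin n → ZMod 2) :
    pauliCoeff (phaseState f) (u, z) = 0 ↔ walsh f u z = 0 := by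
  rw [← abs_eq_zero, abs_pauliCoeff, div_eq_zero_iff, abs_eq_zero]
  simp

lemma trace_mul_pauliT {n : ℕ} (ρ : Matrix (Fin n → ZMod 2) (Fin n → ZMod 2) ℂ)
    (u z : Fin n → ZMod 2) :
    (ρ * pauliT (u, z)).trace =
      ∑ y, ρ y (y + u) * (Complex.I ^ yCount u z * (chi (z ⬝ᵥ y) : ℂ)) := by
  simp only [Matrix.trace, Matrix.diag, Matrix.mul_apply, pauliT_apply, mul_ite, mul_zero,
    Finset.sum_ite_eq', Finset.mem_univ, if_true]

/-- This is the Pauli expansion `|ψ⟩⟨ψ| = ∑ c_ψ(a) T_a` paired with `ρ`; for each `u`, Fourier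
inversion in `z` recovers the entries at distance `u` from the diagonal. -/
lemma sum_pauliCoeff_mul_trace {n : ℕ} (f : (Fin n → ZMod 2) → ZMod 2)
    (ρ : Matrix (Fin n → ZMod 2) (Fin n → ZMod 2) ℂ) :
    ∑ a, (pauliCoeff (phaseState f) a : ℂ) * (ρ * pauliT a).trace =
      star (phaseState f) ⬝ᵥ ρ.mulVec (phaseState f) := by
  have h4 : (4 : ℝ) ^ n = 2 ^ n * 2 ^ n := by rw [← mul_pow]; norm_num
  rw [Fintype.sum_prod_type]
  have key : ∀ u z : Fin n → ZMod 2,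
      (pauliCoeff (phaseState f) (u, z) : ℂ) * (ρ * pauliT (u, z)).trace =
        ∑ y, ρ y (y + u) * ((walsh f u z * chi (z ⬝ᵥ y) / 4 ^ n : ℝ) : ℂ) := by
    intro u z
    rw [ofReal_pauliCoeff, trace_mul_pauliT, Finset.mul_sum]
    refine Finset.sum_congr rfl fun y _ => ?_
    have hI : Complex.I ^ yCount u z * Complex.I ^ yCount u z = ((chi (u ⬝ᵥ z) : ℝ) : ℂ) := by
      rw [← mul_pow, Complex.I_mul_I, chi_dotProduct_eq]
      push_cast; rfl
    calc _ = ρ y (y + u) * ((Complex.I ^ yCount u z * Complex.I ^ yCount u z) *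
          ((walsh f u z / 4 ^ n : ℝ) : ℂ) * (chi (z ⬝ᵥ y) : ℂ)) := by ring
      _ = _ := by
          rw [hI, ← Complex.ofReal_mul, ← Complex.ofReal_mul, ← mul_div_assoc, chi_mul_walsh]
          congr 2
          ring
  simp only [key]
  have hR : star (phaseState f) ⬝ᵥ ρ.mulVec (phaseState f) =
      ∑ y, ∑ x, phaseState f y * (ρ y x * phaseState f x) := by
    rw [star_phaseState]
    simp only [dotProduct, Matrix.mulVec, Finset.mul_sum]
  rw [hR]
  have key2 : ∀ u : Fin n → ZMod 2,
      ∑ z, ∑ y, ρ y (y + u) * ((walsh f u z * chi (z ⬝ᵥ y) / 4 ^ n : ℝ) : ℂ) =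
        ∑ y, phaseState f y * (ρ y (y + u) * phaseState f (y + u)) := by
    intro u
    rw [Finset.sum_comm]
    refine Finset.sum_congr rfl fun y _ => ?_
    rw [← Finset.mul_sum, ← Complex.ofReal_sum, ← Finset.sum_div, sum_walsh_mul_chi,
      mul_left_comm, phaseState_mul, h4, mul_div_mul_left _ _ (by positivity)]
  rw [Finset.sum_congr rfl fun u _ => key2 u, Finset.sum_comm]
  refine Finset.sum_congr rfl fun y _ => ?_
  exact Equiv.sum_comp (Equiv.addLeft y)
    fun x => phaseState f y * (ρ y x * phaseState f x)

/-! ### Mean, second moment and maximal variance of the estimator -/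

lemma sum_zmod_two {M : Type*} [AddCommMonoid M] (g : ZMod 2 → M) : ∑ p, g p = g 0 + g 1 :=
  Fin.sum_univ_two g

/-- The second moment of the one-round estimator, which does not depend on the input state. -/
noncomputable def dfeSecondMoment {n : ℕ} (α : ℝ) (ψ : (Fin n → ZMod 2) → ℂ) : ℝ :=
  ∑ a, |pauliCoeff ψ a| ^ (2 * α) / dfeNorm α ψ * dfeEstimator α ψ (a, 0) ^ 2

lemma dfeEstimator_one {n : ℕ} (α : ℝ) (ψ : (Fin n → ZMod 2) → ℂ)
    (a : (Fin n → ZMod 2) × (Fin n → ZMod 2)) :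
    dfeEstimator α ψ (a, 1) = -dfeEstimator α ψ (a, 0) := by
  simp [dfeEstimator, ZMod.val_one]

lemma re_trace_mul_pauliProj_zero {n : ℕ} {ρ : Matrix (Fin n → ZMod 2) (Fin n → ZMod 2) ℂ}
    (hρ : IsDensityMatrix ρ) (a : (Fin n → ZMod 2) × (Fin n → ZMod 2)) :
    (ρ * pauliProj a 0).trace.re = (1 + (ρ * pauliT a).trace.re) / 2 := by
  simp [pauliProj, mul_add, hρ.2]
  ring

lemma re_trace_mul_pauliProj_one {n : ℕ} {ρ : Matrix (Fin n → ZMod 2) (Fin n → ZMod 2) ℂ}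
    (hρ : IsDensityMatrix ρ) (a : (Fin n → ZMod 2) × (Fin n → ZMod 2)) :
    (ρ * pauliProj a 1).trace.re = (1 - (ρ * pauliT a).trace.re) / 2 := by
  simp [pauliProj, mul_add, hρ.2, ZMod.val_one]
  ring

/-- The output is scaled to undo the sampling bias. This gives unbiasedness, and removes one factor
of the estimator from the second moment. -/
lemma prob_mul_estimator {n : ℕ} {α : ℝ} {ψ : (Fin n → ZMod 2) → ℂ} (hS : dfeNorm α ψ ≠ 0)
    (a : (Fin n → ZMod 2) × (Fin n → ZMod 2)) :
    |pauliCoeff ψ a| ^ (2 * α) / dfeNorm α ψ * dfeEstimator α ψ (a, 0) = pauliCoeff ψ a := by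
  simp only [dfeEstimator, ZMod.val_zero, pow_zero, one_mul]
  rcases eq_or_ne (pauliCoeff ψ a) 0 with h | h
  · simp [h]
  · have h1 : |pauliCoeff ψ a| ^ (2 * α) * |pauliCoeff ψ a| ^ (1 - 2 * α) = |pauliCoeff ψ a| := by
      rw [← Real.rpow_add (abs_pos.mpr h), add_sub_cancel, Real.rpow_one]
    calc _ = |pauliCoeff ψ a| ^ (2 * α) * |pauliCoeff ψ a| ^ (1 - 2 * α) *
          Real.sign (pauliCoeff ψ a) := by field_simp
      _ = _ := by
          rw [h1]
          rcases h.lt_or_gt with h | h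
          · rw [abs_of_neg h, Real.sign_of_neg h]; ring
          · rw [abs_of_pos h, Real.sign_of_pos h]; ring

lemma dfeMean_phaseState {n : ℕ} {α : ℝ} {f : (Fin n → ZMod 2) → ZMod 2}
    (hS : dfeNorm α (phaseState f) ≠ 0) {ρ : Matrix (Fin n → ZMod 2) (Fin n → ZMod 2) ℂ}
    (hρ : IsDensityMatrix ρ) : dfeMean α (phaseState f) ρ = expval (phaseState f) ρ := by
  rw [expval, ← sum_pauliCoeff_mul_trace, Complex.re_sum, dfeMean, Fintype.sum_prod_type]
  refine Finset.sum_congr rfl fun a _ => ?_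
  rw [sum_zmod_two, Complex.re_ofReal_mul, ← prob_mul_estimator hS]
  simp only [dfeProb, dfeEstimator_one, re_trace_mul_pauliProj_zero hρ,
    re_trace_mul_pauliProj_one hρ]
  ring

lemma sum_dfeProb {n : ℕ} {α : ℝ} {ψ : (Fin n → ZMod 2) → ℂ}
    (hS : dfeNorm α ψ ≠ 0) {ρ : Matrix (Fin n → ZMod 2) (Fin n → ZMod 2) ℂ}
    (hρ : IsDensityMatrix ρ) : ∑ ω, dfeProb α ψ ρ ω = 1 := by
  rw [Fintype.sum_prod_type, ← div_self hS]
  nth_rewrite 1 [dfeNorm]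
  rw [Finset.sum_div]
  refine Finset.sum_congr rfl fun a _ => ?_
  rw [sum_zmod_two]
  simp only [dfeProb, re_trace_mul_pauliProj_zero hρ, re_trace_mul_pauliProj_one hρ]
  ring

lemma sum_dfeProb_mul_sq {n : ℕ} (α : ℝ) (ψ : (Fin n → ZMod 2) → ℂ)
    {ρ : Matrix (Fin n → ZMod 2) (Fin n → ZMod 2) ℂ} (hρ : IsDensityMatrix ρ) :
    ∑ ω, dfeProb α ψ ρ ω * dfeEstimator α ψ ω ^ 2 = dfeSecondMoment α ψ := by
  rw [Fintype.sum_prod_type]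
  refine Finset.sum_congr rfl fun a _ => ?_
  rw [sum_zmod_two]
  simp only [dfeProb, dfeEstimator_one, re_trace_mul_pauliProj_zero hρ,
    re_trace_mul_pauliProj_one hρ]
  ring

lemma dfeVariance_add_sq {n : ℕ} {α : ℝ} {f : (Fin n → ZMod 2) → ZMod 2}
    (hS : dfeNorm α (phaseState f) ≠ 0) {ρ : Matrix (Fin n → ZMod 2) (Fin n → ZMod 2) ℂ}
    (hρ : IsDensityMatrix ρ) :
    dfeVariance α (phaseState f) ρ + expval (phaseState f) ρ ^ 2 =
      dfeSecondMoment α (phaseState f) := by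
  rw [← sum_dfeProb_mul_sq α _ hρ, ← dfeMean_phaseState hS hρ, dfeVariance]
  set m := dfeMean α (phaseState f) ρ with hm
  have h : ∀ ω, dfeProb α (phaseState f) ρ ω * (dfeEstimator α (phaseState f) ω - m) ^ 2 =
      dfeProb α (phaseState f) ρ ω * dfeEstimator α (phaseState f) ω ^ 2 -
        2 * m * (dfeProb α (phaseState f) ρ ω * dfeEstimator α (phaseState f) ω) +
        m ^ 2 * dfeProb α (phaseState f) ρ ω := fun ω => by ring
  simp only [h, Finset.sum_add_distrib, Finset.sum_sub_distrib, ← Finset.mul_sum,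
    sum_dfeProb hS hρ]
  rw [← dfeMean, ← hm]
  ring

/-- Multiplying the amplitudes of the state by a nontrivial character `chi (w ⬝ᵥ x)` gives an
orthogonal pure state. -/
lemma exists_density_expval_eq_zero {n : ℕ} (hn : 1 ≤ n) (f : (Fin n → ZMod 2) → ZMod 2) :
    ∃ ρ : Matrix (Fin n → ZMod 2) (Fin n → ZMod 2) ℂ,
      IsDensityMatrix ρ ∧ expval (phaseState f) ρ = 0 := by
  let w : Fin n → ZMod 2 := Pi.single ⟨0, hn⟩ 1
  have hw : w ≠ 0 := by simp [w]
  let φ : (Fin n → ZMod 2) → ℂ := phaseState fun x => f x + w ⬝ᵥ x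
  have hφ : star φ = φ := star_phaseState _
  have h2 : ((2 : ℂ) ^ n) ≠ 0 := by positivity
  refine ⟨Matrix.vecMulVec φ (star φ), ⟨Matrix.posSemidef_vecMulVec_self_star φ, ?_⟩, ?_⟩
  · rw [Matrix.trace_vecMulVec, hφ, dotProduct]
    simp only [φ, phaseState_mul, CharTwo.add_self_eq_zero, chi_zero]
    simp [h2]
  · have h0 : φ ⬝ᵥ phaseState f = 0 := by
      have hx : ∀ x, φ x * phaseState f x = ((chi (w ⬝ᵥ x) / 2 ^ n : ℝ) : ℂ) := fun x => by
        rw [show φ x = phaseState _ x from rfl, phaseState_mul, add_right_comm, CharTwo.add_self_eq_zero, zero_add]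
      rw [dotProduct, Finset.sum_congr rfl fun x _ => hx x, ← Complex.ofReal_sum,
        ← Finset.sum_div, sum_chi_dotProduct, if_neg hw]
      simp
    rw [expval, Matrix.vecMulVec_mulVec, hφ, h0]
    simp

lemma isGreatest_dfeVariance {n : ℕ} (hn : 1 ≤ n) {α : ℝ} {f : (Fin n → ZMod 2) → ZMod 2}
    (hS : dfeNorm α (phaseState f) ≠ 0) :
    IsGreatest {v : ℝ | ∃ ρ : Matrix (Fin n → ZMod 2) (Fin n → ZMod 2) ℂ,
      IsDensityMatrix ρ ∧ v = dfeVariance α (phaseState f) ρ}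
      (dfeSecondMoment α (phaseState f)) := by
  constructor
  · obtain ⟨ρ, hρ, h0⟩ := exists_density_expval_eq_zero hn f
    refine ⟨ρ, hρ, ?_⟩
    rw [← dfeVariance_add_sq hS hρ, h0]
    ring
  · rintro v ⟨ρ, hρ, rfl⟩
    rw [← dfeVariance_add_sq hS hρ]
    linarith [sq_nonneg (expval (phaseState f) ρ)]

lemma dfeSecondMoment_one {n : ℕ} {ψ : (Fin n → ZMod 2) → ℂ} (hS : dfeNorm 1 ψ ≠ 0) :
    dfeSecondMoment 1 ψ =
      dfeNorm 1 ψ * ∑ a, if pauliCoeff ψ a = 0 then 0 else 1 := by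
  rw [dfeSecondMoment, Finset.mul_sum]
  refine Finset.sum_congr rfl fun a _ => ?_
  rw [sq, ← mul_assoc, prob_mul_estimator hS]
  simp only [dfeEstimator, ZMod.val_zero, pow_zero, one_mul]
  split_ifs with h
  · simp [h]
  · rw [show (1 : ℝ) - 2 * 1 = -1 by norm_num, Real.rpow_neg_one]
    have habs : |pauliCoeff ψ a| ≠ 0 := abs_ne_zero.mpr h
    field_simp
    rcases lt_or_gt_of_ne h with h | h
    · rw [abs_of_neg h, Real.sign_of_neg h]; ring
    · rw [abs_of_pos h, Real.sign_of_pos h]; ring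

lemma dfeSecondMoment_half {n : ℕ} {ψ : (Fin n → ZMod 2) → ℂ} (hS : dfeNorm (1 / 2) ψ ≠ 0) :
    dfeSecondMoment (1 / 2) ψ = dfeNorm (1 / 2) ψ ^ 2 := by
  have : ∀ a, |pauliCoeff ψ a| ^ (2 * (1 / 2 : ℝ)) / dfeNorm (1 / 2) ψ *
      dfeEstimator (1 / 2) ψ (a, 0) ^ 2 =
      dfeNorm (1 / 2) ψ * |pauliCoeff ψ a| ^ (2 * (1 / 2 : ℝ)) := fun a => by
    rw [sq, ← mul_assoc, prob_mul_estimator hS]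
    simp only [dfeEstimator, ZMod.val_zero, pow_zero, one_mul]
    rw [show 2 * (1 / 2 : ℝ) = 1 by norm_num, sub_self, Real.rpow_zero, Real.rpow_one]
    rcases lt_trichotomy (pauliCoeff ψ a) 0 with h | h | h
    · rw [abs_of_neg h, Real.sign_of_neg h]; ring
    · simp [h]
    · rw [abs_of_pos h, Real.sign_of_pos h]; ring
  rw [dfeSecondMoment, Finset.sum_congr rfl fun a _ => this a, ← Finset.mul_sum, ← dfeNorm, sq]

/-! ### Walsh spectra of quadratic derivatives -/

section Quadratic

variable {n : ℕ} {f : (Fin n → ZMod 2) → ZMod 2} {u : Fin n → ZMod 2}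
  {L : (Fin n → ZMod 2) →+ (Fin n → ZMod 2)}

/-- The size of the kernel of `L`. -/
def kerCard (L : (Fin n → ZMod 2) →+ (Fin n → ZMod 2)) : ℝ :=
  ∑ d, if L d = 0 then 1 else 0

lemma kerCard_pos : 0 < kerCard L :=
  Finset.sum_pos' (fun d _ => by split_ifs <;> norm_num) ⟨0, Finset.mem_univ _, by simp⟩

lemma walsh_sq_eq_sum
    (hq : ∀ y d, f y + f (y + u) + (f (y + d) + f (y + d + u)) =
      f 0 + f u + (f d + f (d + u)) + L d ⬝ᵥ y) (z : Fin n → ZMod 2) :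
    walsh f u z ^ 2 =
      2 ^ n * ∑ d, if L d = 0 then chi (f 0 + f u + (f d + f (d + u)) + z ⬝ᵥ d) else 0 := by
  have h1 : walsh f u z ^ 2 =
      ∑ y, ∑ d, chi (f 0 + f u + (f d + f (d + u)) + z ⬝ᵥ d) * chi (L d ⬝ᵥ y) := by
    rw [sq, walsh, Finset.sum_mul]
    refine Finset.sum_congr rfl fun y _ => ?_
    -- The second summation variable is written as `y + d`; by `hq` the exponent is then affine in
    -- `y`, and the sum over `y` forces `L d = 0`.
    rw [← Equiv.sum_comp (Equiv.addLeft y), Finset.mul_sum]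
    refine Finset.sum_congr rfl fun d _ => ?_
    rw [Equiv.coe_addLeft, ← chi_add, ← chi_add, dotProduct_add]
    congr 1
    have h2 : z ⬝ᵥ y + z ⬝ᵥ y = 0 := CharTwo.add_self_eq_zero _
    linear_combination hq y d + h2
  rw [h1, Finset.sum_comm, Finset.mul_sum]
  refine Finset.sum_congr rfl fun d _ => ?_
  rw [← Finset.mul_sum, sum_chi_dotProduct]
  split_ifs <;> ring

/-- On the kernel of `L` the exponent `q` is additive, so the sum of `chi ∘ q` there is the full
size of the kernel if the character is trivial, and zero otherwise. -/
lemma walsh_sq_eq_zero_or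
    (hq : ∀ y d, f y + f (y + u) + (f (y + d) + f (y + d + u)) =
      f 0 + f u + (f d + f (d + u)) + L d ⬝ᵥ y) (z : Fin n → ZMod 2) :
    walsh f u z = 0 ∨ walsh f u z ^ 2 = 2 ^ n * kerCard L := by
  have hw := walsh_sq_eq_sum hq z
  set q : (Fin n → ZMod 2) → ZMod 2 := fun d => f 0 + f u + (f d + f (d + u)) + z ⬝ᵥ d with hqd
  have hadd : ∀ d d', L d' = 0 → q (d + d') = q d + q d' := fun d d' h' => by
    have h := hq d d'
    rw [h', zero_dotProduct, add_zero] at h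
    have h2 : f d + f (d + u) + (f d + f (d + u)) = 0 := CharTwo.add_self_eq_zero _
    simp only [hqd, dotProduct_add]
    linear_combination h - h2
  by_cases hall : ∀ d, L d = 0 → chi (q d) = 1
  · right
    rw [hw, kerCard]
    congr 1
    refine Finset.sum_congr rfl fun d _ => ?_
    split_ifs with h
    · exact hall d h
    · rfl
  · left
    push Not at hall
    obtain ⟨d₀, hd₀, hne⟩ := hall
    have h1 := (chi_eq (q d₀)).resolve_left hne
    have h2 : (∑ d, if L (d + d₀) = 0 then chi (q (d + d₀)) else 0) =
        ∑ d, if L d = 0 then chi (q d) else 0 :=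
      Equiv.sum_comp (Equiv.addRight d₀) fun d => if L d = 0 then chi (q d) else 0
    have h3 : ∀ d, (if L (d + d₀) = 0 then chi (q (d + d₀)) else 0) =
        -(if L d = 0 then chi (q d) else 0) := fun d => by
      rw [map_add, hd₀, add_zero, hadd d d₀ hd₀, chi_add, h1]
      split_ifs <;> ring
    rw [Finset.sum_congr rfl fun d _ => h3 d, Finset.sum_neg_distrib] at h2
    rw [← sq_eq_zero_iff, hw]
    have : (∑ d, if L d = 0 then chi (q d) else 0) = 0 := by linarith
    simp only [hqd] at this
    rw [this, mul_zero]

/-- All nonzero squares are equal, so Parseval determines how many there are. -/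
lemma sum_walsh_ne_zero
    (hq : ∀ y d, f y + f (y + u) + (f (y + d) + f (y + d + u)) =
      f 0 + f u + (f d + f (d + u)) + L d ⬝ᵥ y) :
    (∑ z, if walsh f u z = 0 then (0 : ℝ) else 1) = 2 ^ n / kerCard L := by
  have hk := kerCard_pos (L := L)
  have h := sum_walsh_sq f u
  have h1 : ∀ z, walsh f u z ^ 2 =
      (2 ^ n * kerCard L) * (if walsh f u z = 0 then (0 : ℝ) else 1) := fun z => by
    split_ifs with h0
    · simp [h0]
    · rw [(walsh_sq_eq_zero_or hq z).resolve_left h0, mul_one]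
  rw [Finset.sum_congr rfl fun z _ => h1 z, ← Finset.mul_sum,
    show (4 : ℝ) ^ n = 2 ^ n * 2 ^ n by rw [← mul_pow]; norm_num, mul_assoc] at h
  rw [eq_div_iff hk.ne', mul_comm]
  exact mul_left_cancel₀ (by positivity) h

lemma sum_abs_walsh
    (hq : ∀ y d, f y + f (y + u) + (f (y + d) + f (y + d + u)) =
      f 0 + f u + (f d + f (d + u)) + L d ⬝ᵥ y) :
    ∑ z, |walsh f u z| = 2 ^ n * √(2 ^ n / kerCard L) := by
  have hk := kerCard_pos (L := L)
  have h1 : ∀ z, |walsh f u z| =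
      √(2 ^ n * kerCard L) * (if walsh f u z = 0 then (0 : ℝ) else 1) := fun z => by
    split_ifs with h0
    · simp [h0]
    · rw [← (walsh_sq_eq_zero_or hq z).resolve_left h0, Real.sqrt_sq_eq_abs, mul_one]
  rw [Finset.sum_congr rfl fun z _ => h1 z, ← Finset.mul_sum, sum_walsh_ne_zero hq,
    Real.sqrt_mul (by positivity), Real.sqrt_div (by positivity)]
  have h2 := Real.sq_sqrt hk.le
  have h3 : √(kerCard L) ≠ 0 := (Real.sqrt_pos.mpr hk).ne'
  field_simp
  rw [h2]

end Quadratic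

lemma dfeNorm_one_phaseState {n : ℕ} (f : (Fin n → ZMod 2) → ZMod 2) :
    dfeNorm 1 (phaseState f) = 1 / 2 ^ n := by
  rw [dfeNorm, Fintype.sum_prod_type]
  have h : ∀ u z, |pauliCoeff (phaseState f) (u, z)| ^ (2 * (1 : ℝ)) =
      walsh f u z ^ 2 / (4 ^ n) ^ 2 := fun u z => by
    rw [mul_one, Real.rpow_two, abs_pauliCoeff, div_pow, sq_abs]
  simp only [h, ← Finset.sum_div, sum_walsh_sq]
  simp only [Finset.sum_const, Finset.card_univ, Fintype.card_pi, ZMod.card,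
    Finset.prod_const, Fintype.card_fin, nsmul_eq_mul]
  rw [show (4 : ℝ) ^ n = 2 ^ n * 2 ^ n by rw [← mul_pow]; norm_num]
  push_cast
  field_simp

section Cubic

variable {n : ℕ} {f : (Fin n → ZMod 2) → ZMod 2}
  {L : (Fin n → ZMod 2) → (Fin n → ZMod 2) →+ (Fin n → ZMod 2)}

lemma dfeNorm_half_phaseState
    (hq : ∀ u y d, f y + f (y + u) + (f (y + d) + f (y + d + u)) =
      f 0 + f u + (f d + f (d + u)) + L u d ⬝ᵥ y) :
    dfeNorm (1 / 2) (phaseState f) = (∑ u, √(2 ^ n / kerCard (L u))) / 2 ^ n := by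
  rw [dfeNorm, Fintype.sum_prod_type]
  have h : ∀ u z, |pauliCoeff (phaseState f) (u, z)| ^ (2 * (1 / 2 : ℝ)) =
      |walsh f u z| / 4 ^ n := fun u z => by
    rw [show 2 * (1 / 2 : ℝ) = 1 by norm_num, Real.rpow_one, abs_pauliCoeff]
  simp only [h, ← Finset.sum_div, sum_abs_walsh (hq _), ← Finset.mul_sum]
  rw [show (4 : ℝ) ^ n = 2 ^ n * 2 ^ n by rw [← mul_pow]; norm_num,
    mul_div_mul_left _ _ (by positivity)]

lemma dfeSecondMoment_one_phaseState
    (hq : ∀ u y d, f y + f (y + u) + (f (y + d) + f (y + d + u)) =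
      f 0 + f u + (f d + f (d + u)) + L u d ⬝ᵥ y) :
    dfeSecondMoment 1 (phaseState f) = (∑ u, 2 ^ n / kerCard (L u)) / 2 ^ n := by
  rw [dfeSecondMoment_one (by rw [dfeNorm_one_phaseState]; positivity), dfeNorm_one_phaseState,
    Fintype.sum_prod_type]
  simp only [pauliCoeff_eq_zero_iff, sum_walsh_ne_zero (hq _)]
  ring

lemma dfeNorm_half_phaseState_ne_zero
    (hq : ∀ u y d, f y + f (y + u) + (f (y + d) + f (y + d + u)) =
      f 0 + f u + (f d + f (d + u)) + L u d ⬝ᵥ y) :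
    dfeNorm (1 / 2) (phaseState f) ≠ 0 := by
  rw [dfeNorm_half_phaseState hq]
  have h : ∀ u, 0 < √(2 ^ n / kerCard (L u)) := fun u => by
    have := kerCard_pos (L := L u)
    positivity
  have : 0 < ∑ u, √(2 ^ n / kerCard (L u)) :=
    Finset.sum_pos (fun u _ => h u) Finset.univ_nonempty
  positivity

lemma dfeSecondMoment_half_phaseState
    (hq : ∀ u y d, f y + f (y + u) + (f (y + d) + f (y + d + u)) =
      f 0 + f u + (f d + f (d + u)) + L u d ⬝ᵥ y) :
    dfeSecondMoment (1 / 2) (phaseState f) =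
      ((∑ u, √(2 ^ n / kerCard (L u))) / 2 ^ n) ^ 2 := by
  rw [dfeSecondMoment_half (dfeNorm_half_phaseState_ne_zero hq), dfeNorm_half_phaseState hq]

end Cubic

/-! ### The cubic of the complete state and its polar maps -/

/-- The Hamming weight. -/
def bitWeight {n : ℕ} (x : Fin n → ZMod 2) : ℕ := ∑ i, (x i).val

/-- The parity of the Hamming weight. -/
def parity {n : ℕ} (x : Fin n → ZMod 2) : ZMod 2 := ∑ i, x i

/-- The second elementary symmetric polynomial of the bits. -/
def pairPoly {n : ℕ} (x : Fin n → ZMod 2) : ZMod 2 := ((bitWeight x).choose 2 : ℕ)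

lemma cast_bitWeight {n : ℕ} (x : Fin n → ZMod 2) : (bitWeight x : ZMod 2) = parity x := by
  simp [bitWeight, parity]

lemma parity_add {n : ℕ} (x y : Fin n → ZMod 2) : parity (x + y) = parity x + parity y :=
  Finset.sum_add_distrib

lemma bitWeight_add {n : ℕ} (x y : Fin n → ZMod 2) :
    bitWeight (x + y) + 2 * ∑ i, (x i).val * (y i).val = bitWeight x + bitWeight y := by
  have h : ∀ a b : ZMod 2, (a + b).val + 2 * (a.val * b.val) = a.val + b.val := by decide
  simp only [bitWeight, Finset.mul_sum, ← Finset.sum_add_distrib, Pi.add_apply, h]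

lemma add_choose_two (a b : ℕ) : (a + b).choose 2 = a.choose 2 + b.choose 2 + a * b := by
  induction b with
  | zero => simp
  | succ b ih =>
    rw [← add_assoc, Nat.choose_succ_succ' (a + b) 1, Nat.choose_succ_succ' b 1, ih]
    simp only [Nat.choose_one_right]
    ring

lemma cast_two_mul_choose_two (c : ℕ) : (((2 * c).choose 2 : ℕ) : ZMod 2) = c := by
  induction c with
  | zero => simp
  | succ c ih =>
    rw [mul_add, mul_one, add_choose_two]
    push_cast
    rw [ih, Nat.choose_self]
    have h2 : (2 : ZMod 2) = 0 := rfl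
    rw [h2]
    simp

/-- Take `choose 2` modulo 2 on both sides of `|x + y| + 2|x ∧ y| = |x| + |y|`: the term `choose
(2c) 2` reduces to `c = |x ∧ y|`, giving the dot product. -/
lemma pairPoly_add {n : ℕ} (x y : Fin n → ZMod 2) :
    pairPoly (x + y) = pairPoly x + pairPoly y + parity x * parity y + x ⬝ᵥ y := by
  have h := congrArg (fun k : ℕ => ((k.choose 2 : ℕ) : ZMod 2)) (bitWeight_add x y)
  simp only [add_choose_two (bitWeight _)] at h
  push_cast at h
  rw [cast_two_mul_choose_two] at h
  push_cast at h
  simp only [ZMod.natCast_val, ZMod.cast_id', id_eq, cast_bitWeight] at h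
  have h2 : (2 : ZMod 2) = 0 := rfl
  rw [h2, zero_mul, mul_zero, add_zero] at h
  simp only [pairPoly, dotProduct]
  rw [← h, add_assoc, CharTwo.add_self_eq_zero, add_zero]

lemma cast_choose_three (w : ℕ) : ((w.choose 3 : ℕ) : ZMod 2) = w * (w.choose 2 : ℕ) := by
  have h2 : (2 : ZMod 2) = 0 := rfl
  have h3 : (3 : ZMod 2) = 1 := rfl
  rcases lt_or_ge w 2 with hw | hw
  · rw [Nat.choose_eq_zero_of_lt (by omega), Nat.choose_eq_zero_of_lt hw]
    simp
  · have h := congrArg (Nat.cast : ℕ → ZMod 2) (Nat.choose_succ_right_eq w 2)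
    push_cast [Nat.cast_sub hw] at h
    rw [h3, mul_one, h2, sub_zero] at h
    rw [h]
    ring

/-- A monomial equals 1 exactly when its hyperedge lies in the support of `x`, so the sum is `choose
w 3` for the weight `w`; modulo 2 this is `w * choose w 2`. -/
lemma hypergraphPoly_complete {n : ℕ} (x : Fin n → ZMod 2) :
    hypergraphPoly (Finset.powersetCard 3 (Finset.univ : Finset (Fin n))) x =
      parity x * pairPoly x := by
  rw [pairPoly, ← cast_bitWeight, ← cast_choose_three]
  have hw : bitWeight x = (Finset.univ.filter fun i => x i = 1).card := by
    rw [Finset.card_filter]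
    refine Finset.sum_congr rfl fun i _ => ?_
    rcases zmod_two_eq (x i) with h | h <;> simp [h, ZMod.val_one]
  have hf : Finset.powersetCard 3 (Finset.univ.filter fun i => x i = 1) =
      (Finset.powersetCard 3 (Finset.univ : Finset (Fin n))).filter
        fun A => ∀ i ∈ A, x i = 1 := by
    ext A
    simp only [Finset.mem_powersetCard, Finset.mem_filter, true_and,
      Finset.subset_iff, Finset.mem_univ]
    tauto
  rw [hw, ← Finset.card_powersetCard, hf, Finset.card_filter, hypergraphPoly]
  push_cast
  refine Finset.sum_congr rfl fun A _ => ?_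
  split_ifs with h
  · exact Finset.prod_eq_one h
  · push Not at h
    obtain ⟨i, hi, hx⟩ := h
    exact Finset.prod_eq_zero hi ((zmod_two_eq _).resolve_right hx)

/-- The derivative in the direction `u` of `parity * pairPoly` is a quadratic form; this is the
linear map of its polar form. -/
def polarMap {n : ℕ} (u : Fin n → ZMod 2) : (Fin n → ZMod 2) →+ (Fin n → ZMod 2) where
  toFun d := (parity u * parity d + u ⬝ᵥ d) • 1 + parity u • d + parity d • u
  map_zero' := by ext j; simp [parity]
  map_add' d d' := by
    ext j
    simp only [parity_add, dotProduct_add, Pi.add_apply, Pi.smul_apply, smul_eq_mul, Pi.one_apply]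
    ring

lemma polarMap_apply {n : ℕ} (u d : Fin n → ZMod 2) : polarMap u d =
    (parity u * parity d + u ⬝ᵥ d) • 1 + parity u • d + parity d • u := rfl

lemma one_dotProduct_eq_parity {n : ℕ} (y : Fin n → ZMod 2) : 1 ⬝ᵥ y = parity y := by
  simp [dotProduct, parity]

lemma complete_polar {n : ℕ} (u y d : Fin n → ZMod 2) :
    parity y * pairPoly y + parity (y + u) * pairPoly (y + u) +
      (parity (y + d) * pairPoly (y + d) + parity (y + d + u) * pairPoly (y + d + u)) =
    parity (0 : Fin n → ZMod 2) * pairPoly (0 : Fin n → ZMod 2) + parity u * pairPoly u +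
      (parity d * pairPoly d + parity (d + u) * pairPoly (d + u)) + polarMap u d ⬝ᵥ y := by
  have h0 : parity (0 : Fin n → ZMod 2) = 0 := by simp [parity]
  simp only [polarMap_apply, add_dotProduct, smul_dotProduct, one_dotProduct_eq_parity, pairPoly_add,
    parity_add, h0, smul_eq_mul, dotProduct_comm d u, dotProduct_comm d y, dotProduct_comm u y]
  generalize parity y = a
  generalize parity u = b
  generalize parity d = c
  generalize pairPoly y = a'
  generalize pairPoly u = b'
  generalize pairPoly d = c'
  generalize y ⬝ᵥ u = p
  generalize y ⬝ᵥ d = q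
  generalize u ⬝ᵥ d = r
  grind

lemma parity_one (n : ℕ) : parity (1 : Fin n → ZMod 2) = n := by
  simp [parity]

lemma dotProduct_self_bits {n : ℕ} (u : Fin n → ZMod 2) : u ⬝ᵥ u = parity u := by
  have h : ∀ a : ZMod 2, a * a = a := by decide
  simp [dotProduct, parity, h]

lemma kerCard_eq_card {n : ℕ} {L : (Fin n → ZMod 2) →+ (Fin n → ZMod 2)}
    {s : Finset (Fin n → ZMod 2)} (h : ∀ d, L d = 0 ↔ d ∈ s) : kerCard L = s.card := by
  rw [kerCard, Finset.sum_boole]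
  congr 2
  ext d
  simp [h]

/-- This confines the kernel to the span of `1` and `u`. Taking parities excludes `1` and `u + 1`
for odd `n`; for even `n` the whole span survives. -/
lemma polarMap_eq_zero_iff_of_parity_one {n : ℕ} {u : Fin n → ZMod 2} (hu : parity u = 1)
    (d : Fin n → ZMod 2) :
    polarMap u d = 0 ↔ d = (parity d + u ⬝ᵥ d) • 1 + parity d • u := by
  rw [polarMap_apply, hu, one_mul, one_smul, funext_iff, funext_iff]
  refine forall_congr' fun j => ?_
  simp only [Pi.add_apply, Pi.smul_apply, smul_eq_mul, Pi.one_apply, Pi.zero_apply]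
  generalize parity d + u ⬝ᵥ d = a
  generalize parity d * u j = b
  generalize d j = c
  revert a b c
  decide

lemma kerCard_polarMap_of_odd {n : ℕ} (hn : Odd n) {u : Fin n → ZMod 2} (hu : parity u = 1) :
    kerCard (polarMap u) = 2 := by
  have hn1 : (n : ZMod 2) = 1 := by
    obtain ⟨m, rfl⟩ := hn
    have h2 : (2 : ZMod 2) = 0 := rfl
    push_cast
    rw [h2]; ring
  have hu0 : u ≠ 0 := by
    rintro rfl
    simp [parity] at hu
  rw [kerCard_eq_card (s := {0, u})]
  · rw [Finset.card_pair hu0.symm]; norm_num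
  · intro d
    rw [polarMap_eq_zero_iff_of_parity_one hu, Finset.mem_insert, Finset.mem_singleton]
    constructor
    · intro h
      have h1 := congrArg parity h
      rw [parity_add] at h1
      have hsm : ∀ (a : ZMod 2) (v : Fin n → ZMod 2), parity (a • v) = a * parity v :=
        fun a v => by simp [parity, Finset.mul_sum]
      rw [hsm, hsm, hu, parity_one, hn1, mul_one, mul_one] at h1
      have h2 : parity d + u ⬝ᵥ d = 0 := by linear_combination -h1
      rw [h2, zero_smul, zero_add] at h
      rcases zmod_two_eq (parity d) with hd | hd
      · left; rw [h, hd, zero_smul]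
      · right; rw [h, hd, one_smul]
    · rintro (rfl | rfl)
      · simp [parity]
      · rw [dotProduct_self_bits, hu, CharTwo.add_self_eq_zero]; simp

lemma kerCard_polarMap_of_even {n : ℕ} (hn : Even n) {u : Fin n → ZMod 2} (hu : parity u = 1) :
    kerCard (polarMap u) = 4 := by
  have hn0 : (n : ZMod 2) = 0 := (ZMod.natCast_eq_zero_iff_even).mpr hn
  have hp0 : parity (0 : Fin n → ZMod 2) = 0 := by simp [parity]
  have hp1 : parity (1 : Fin n → ZMod 2) = 0 := by rw [parity_one, hn0]
  have hu0 : u ≠ 0 := by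
    rintro rfl
    rw [hp0] at hu
    exact zero_ne_one hu
  have hu1 : u ≠ 1 := by
    rintro rfl
    rw [hp1] at hu
    exact zero_ne_one hu
  have h10 : (1 : Fin n → ZMod 2) ≠ 0 := by
    intro h
    apply hu0
    rw [← mul_one u, h, mul_zero]
  have hu2 : u + 1 ≠ 0 := fun h => hu1 (by rw [← add_add_cancel_bits u 1, h, zero_add])
  rw [kerCard_eq_card (s := {0, u, 1, u + 1})]
  · rw [Finset.card_insert_of_notMem, Finset.card_insert_of_notMem, Finset.card_pair]
    · norm_num
    · simpa using hu0
    · simp [hu1, h10]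
    · simp [hu0.symm, h10.symm, hu2.symm]
  · intro d
    rw [polarMap_eq_zero_iff_of_parity_one hu]
    simp only [Finset.mem_insert, Finset.mem_singleton]
    constructor
    · intro h
      rcases zmod_two_eq (parity d) with hd | hd <;>
        rcases zmod_two_eq (u ⬝ᵥ d) with hq | hq <;> rw [hd, hq] at h
      · left; simpa using h
      · right; right; left; simpa using h
      · right; right; right; rw [h]; simp [add_comm]
      · right; left; rw [CharTwo.add_self_eq_zero] at h; simpa using h
    · have hd1 : u ⬝ᵥ 1 = 1 := by rw [dotProduct_comm, one_dotProduct_eq_parity, hu]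
      rintro (rfl | rfl | rfl | rfl)
      · simp [parity]
      · rw [dotProduct_self_bits, hu, CharTwo.add_self_eq_zero]; simp
      · rw [hd1, hp1]; simp
      · rw [dotProduct_add, parity_add, hd1, dotProduct_self_bits, hu, hp1,
          CharTwo.add_self_eq_zero]
        simp [add_comm]

lemma kerCard_polarMap_of_const {n : ℕ} {u : Fin n → ZMod 2} (hu : parity u = 0)
    (h : u = 0 ∨ u = 1) : kerCard (polarMap u) = 2 ^ n := by
  have hz : ∀ d, polarMap u d = 0 := fun d => by
    rw [polarMap_apply, hu]
    rcases h with rfl | rfl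
    · simp
    · rw [one_dotProduct_eq_parity, zero_mul, zero_add, zero_smul, add_zero, bits_add_self]
  simp [kerCard, hz]

lemma kerCard_polarMap_of_not_const {n : ℕ} {u : Fin n → ZMod 2} (hu : parity u = 0)
    (h0 : u ≠ 0) (h1 : u ≠ 1) : kerCard (polarMap u) = 2 ^ n / 4 := by
  obtain ⟨i, hi⟩ : ∃ i, u i ≠ 1 := by
    by_contra! h
    exact h1 (funext h)
  obtain ⟨j, hj⟩ : ∃ j, u j ≠ 0 := by
    by_contra! h
    exact h0 (funext h)
  have hi := (zmod_two_eq (u i)).resolve_right hi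
  have hj := (zmod_two_eq (u j)).resolve_left hj
  have hker : ∀ d, polarMap u d = 0 ↔ parity d = 0 ∧ u ⬝ᵥ d = 0 := fun d => by
    rw [polarMap_apply, hu, zero_mul, zero_add, zero_smul, add_zero]
    constructor
    · intro h
      have h2 := congrFun h i
      have h3 := congrFun h j
      simp only [Pi.add_apply, Pi.smul_apply, smul_eq_mul, Pi.one_apply, Pi.zero_apply, hi, hj,
        mul_one, mul_zero, add_zero] at h2 h3
      rw [h2, zero_add] at h3
      exact ⟨h3, h2⟩
    · rintro ⟨h2, h3⟩
      rw [h2, h3, zero_smul, zero_smul, add_zero]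
  -- The indicator of the two linear conditions is the average of the characters in the span of `1`
  -- and `u`. These four are distinct, so only the trivial one contributes to the sum over `d`.
  have hind : ∀ d, (if polarMap u d = 0 then (1 : ℝ) else 0) =
      (chi ((0 : Fin n → ZMod 2) ⬝ᵥ d) + chi (1 ⬝ᵥ d) + chi (u ⬝ᵥ d) + chi ((1 + u) ⬝ᵥ d)) / 4 :=
    fun d => by
      simp only [hker, add_dotProduct, one_dotProduct_eq_parity, zero_dotProduct, chi_add]
      rcases zmod_two_eq (parity d) with hd | hd <;>
        rcases zmod_two_eq (u ⬝ᵥ d) with hq | hq <;> (simp [hd, hq]; try norm_num)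
  have h10 : (1 : Fin n → ZMod 2) ≠ 0 := fun h => by simpa using congrFun h i
  have hu2 : 1 + u ≠ 0 := fun h => h1 <| by
    rw [← add_add_cancel_bits u 1, add_comm u 1, h, zero_add]
  rw [kerCard, Finset.sum_congr rfl fun d _ => hind d, ← Finset.sum_div]
  simp only [Finset.sum_add_distrib, sum_chi_dotProduct, if_true, if_neg h10, if_neg h0,
    if_neg hu2, add_zero]

/-! ### Closed forms for the second moments -/

lemma two_pow_div_kerCard {n : ℕ} (hn : 3 ≤ n) (u : Fin n → ZMod 2) :
    2 ^ n / kerCard (polarMap u) =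
      if parity u = 1 then ((2 : ℝ) ^ ((n - 1) / 2)) ^ 2 else if u = 0 ∨ u = 1 then 1 else 4 := by
  split_ifs with h h'
  · rcases Nat.even_or_odd' n with ⟨m, hm | hm⟩
    · rw [kerCard_polarMap_of_even ⟨m, by omega⟩ h, ← pow_mul,
        show (n - 1) / 2 * 2 = n - 2 by omega]
      conv_lhs => rw [show n = n - 2 + 2 by omega, pow_add]
      norm_num
    · rw [kerCard_polarMap_of_odd ⟨m, hm⟩ h, ← pow_mul, show (n - 1) / 2 * 2 = n - 1 by omega]
      conv_lhs => rw [show n = n - 1 + 1 by omega, pow_add]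
      norm_num
  · rw [kerCard_polarMap_of_const ((zmod_two_eq _).resolve_right h) h', div_self (by positivity)]
  · push Not at h'
    rw [kerCard_polarMap_of_not_const ((zmod_two_eq _).resolve_right h) h'.1 h'.2]
    have : (2 : ℝ) ^ n ≠ 0 := by positivity
    field_simp

lemma sum_parity_ite {n : ℕ} (hn : 1 ≤ n) (A B : ℝ) :
    (∑ u : Fin n → ZMod 2, if parity u = 1 then A else if u = 0 ∨ u = 1 then 1 else B) =
      2 ^ n * (A + B) / 2 + (1 - B) * (1 + if Even n then 1 else 0) := by
  have h10 : (1 : Fin n → ZMod 2) ≠ 0 := fun h => by simpa using congrFun h ⟨0, hn⟩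
  have hp0 : parity (0 : Fin n → ZMod 2) = 0 := by simp [parity]
  -- Half the strings get `A` and half get `B`, with corrections `1 - B` at the even-weight constant
  -- strings: `0` always, and `1` when `n` is even.
  have hpt : ∀ u : Fin n → ZMod 2,
      (if parity u = 1 then A else if u = 0 ∨ u = 1 then 1 else B) =
        (A + B) / 2 * chi ((0 : Fin n → ZMod 2) ⬝ᵥ u) + (B - A) / 2 * chi (1 ⬝ᵥ u) +
          ((if u = 0 then 1 - B else 0) +
            if u = 1 then (1 - B) * (if Even n then 1 else 0) else 0) := fun u => by
    rw [one_dotProduct_eq_parity, zero_dotProduct, chi_zero]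
    by_cases hu0 : u = 0
    · subst hu0
      simp [hp0, h10.symm]
      ring
    by_cases hu1 : u = 1
    · subst hu1
      rw [parity_one]
      rcases Nat.even_or_odd n with he | ho
      · rw [(ZMod.natCast_eq_zero_iff_even).mpr he]
        simp [hu0, he]
        ring
      · rw [(ZMod.natCast_eq_one_iff_odd).mpr ho]
        simp [hu0, Nat.not_even_iff_odd.mpr ho]
        ring
    · rcases zmod_two_eq (parity u) with h | h <;> simp [h, hu0, hu1] <;> ring
  rw [Finset.sum_congr rfl fun u _ => hpt u]
  simp only [Finset.sum_add_distrib, ← Finset.mul_sum, sum_chi_dotProduct, if_true, if_neg h10,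
    Finset.sum_ite_eq', Finset.mem_univ]
  ring

/-- The last factor is also the number of constant strings of even weight in `sum_parity_ite`. It
cancels in the mean, so one formula in `x` serves both parities of `n`. -/
lemma two_pow_eq {n : ℕ} (hn : 1 ≤ n) :
    (2 : ℝ) ^ n = 2 * ((2 : ℝ) ^ ((n - 1) / 2)) ^ 2 * (1 + if Even n then 1 else 0) := by
  rw [← pow_mul]
  split_ifs with h
  · obtain ⟨m, rfl⟩ := h
    rw [show (m + m - 1) / 2 * 2 = m + m - 2 by omega]
    conv_lhs => rw [show m + m = m + m - 2 + 2 by omega, pow_add]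
    ring
  · obtain ⟨m, rfl⟩ := Nat.not_even_iff_odd.mp h
    rw [show (2 * m + 1 - 1) / 2 * 2 = 2 * m by omega, pow_succ]
    ring

lemma completeState3_eq (n : ℕ) :
    completeState3 n = phaseState fun x : Fin n → ZMod 2 => parity x * pairPoly x := by
  rw [completeState3, hypergraphState_eq_phaseState]
  congr 1
  exact funext hypergraphPoly_complete

lemma dfeNorm_completeState3_ne_zero (n : ℕ) {α : ℝ} (hα : α = 1 ∨ α = 1 / 2) :
    dfeNorm α (completeState3 n) ≠ 0 := by
  rw [completeState3_eq]
  rcases hα with rfl | rfl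
  · rw [dfeNorm_one_phaseState]; positivity
  · exact dfeNorm_half_phaseState_ne_zero complete_polar

lemma dfeSecondMoment_one_completeState3 {n : ℕ} (hn : 3 ≤ n) {x : ℝ}
    (hx : x = 2 ^ ((n - 1) / 2)) :
    dfeSecondMoment 1 (completeState3 n) = (x ^ 4 + 4 * x ^ 2 - 3) / (2 * x ^ 2) := by
  have hx0 : x ≠ 0 := by rw [hx]; positivity
  rw [completeState3_eq, dfeSecondMoment_one_phaseState complete_polar]
  simp only [two_pow_div_kerCard hn]
  rw [sum_parity_ite (by omega), two_pow_eq (by omega), ← hx]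
  split_ifs <;> field_simp <;> ring

lemma dfeSecondMoment_half_completeState3 {n : ℕ} (hn : 3 ≤ n) {x : ℝ}
    (hx : x = 2 ^ ((n - 1) / 2)) :
    dfeSecondMoment (1 / 2) (completeState3 n) = ((x ^ 3 + 2 * x ^ 2 - 1) / (2 * x ^ 2)) ^ 2 := by
  have hx0 : 0 < x := by rw [hx]; positivity
  have h4 : √(4 : ℝ) = 2 := by
    rw [show (4 : ℝ) = 2 ^ 2 by norm_num, Real.sqrt_sq (by norm_num)]
  rw [completeState3_eq, dfeSecondMoment_half_phaseState complete_polar]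
  simp only [two_pow_div_kerCard hn, apply_ite Real.sqrt, Real.sqrt_one, h4, ← hx,
    Real.sqrt_sq hx0.le]
  rw [sum_parity_ite (by omega), two_pow_eq (by omega), ← hx]
  congr 1
  split_ifs <;> field_simp <;> ring

/-! ### Estimates for the rank distribution -/

lemma sum_hollowFrac_le_one (n k : ℕ) : ∑ h ∈ Finset.range k, hollowFrac n h ≤ 1 := by
  have hle : ∑ h ∈ Finset.range k, hollowCount n (2 * h) ≤ 2 ^ (n * (n - 1) / 2) := by
    simp only [hollowCount_eq_card, Finset.card_filter]
    rw [Finset.sum_comm, ← card_hollowFinset, Finset.card_eq_sum_ones]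
    refine Finset.sum_le_sum fun A _ => ?_
    -- Only `h = A.rank / 2` can satisfy `A.rank = 2 * h`, so each matrix is counted at most once;
    -- evenness of the rank is not needed.
    calc _ ≤ ∑ h ∈ Finset.range k, if A.rank / 2 = h then 1 else 0 :=
          Finset.sum_le_sum fun h _ => by split_ifs <;> omega
      _ ≤ 1 := by
          rw [Finset.sum_ite_eq]
          split_ifs <;> norm_num
  simp only [hollowFrac]
  rw [← Finset.sum_div, div_le_one (by positivity)]
  exact_mod_cast hle

lemma hollowFrac_nonneg (n h : ℕ) : 0 ≤ hollowFrac n h := by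
  unfold hollowFrac; positivity

lemma hollowFrac_odd_succ (m : ℕ) :
    hollowFrac (2 * (m + 1) + 1) (m + 1) =
      (1 - 1 / (8 * 4 ^ m)) * hollowFrac (2 * m + 1) m := by
  have h1 : hollowFormula (2 * (m + 1) + 1) (m + 1) =
      2 ^ (2 * m) * (2 ^ (2 * m + 3) - 1) * hollowFormula (2 * m + 1) m := by
    have hpos : (2 : ℝ) ^ (2 * (m + 1)) - 1 ≠ 0 := by
      have : (1 : ℝ) < 2 ^ (2 * (m + 1)) := one_lt_pow₀ (by norm_num) (by omega)
      linarith
    unfold hollowFormula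
    rw [Finset.prod_Icc_succ_top (by omega), show 2 * (m + 1) - 2 = 2 * m by omega,
      show 2 * (m + 1) = 2 * m + 1 + 1 by ring, prod_range_succ_shift, prod_range_succ_shift]
    rw [show 2 * (m + 1) = 2 * m + 1 + 1 by ring] at hpos
    field_simp
  have h2 : (2 * (m + 1) + 1) * (2 * (m + 1) + 1 - 1) / 2 =
      (2 * m + 1) * (2 * m + 1 - 1) / 2 + (4 * m + 3) := by
    rw [show 2 * (m + 1) + 1 = 2 * m + 1 + 1 + 1 by ring, Nat.triangle_succ, Nat.triangle_succ]
    ring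
  have h3 : (2 : ℝ) ^ (2 * m) = 4 ^ m := by rw [pow_mul]; norm_num
  have h4 : (2 : ℝ) ^ (4 * m) = 4 ^ m * 4 ^ m := by
    rw [show 4 * m = 2 * m + 2 * m by ring, pow_add, h3]
  unfold hollowFrac
  rw [hollowCount_eq_hollowFormula, hollowCount_eq_hollowFormula, h1, h2, pow_add, pow_add,
    pow_add, h3, h4]
  field_simp
  ring

/-- The fractions decrease with `m`, so a bare `3/4` would not pass through the induction. The extra
term, an equality at `m = 0`, absorbs the factor `1 - 1/(8 * 4^m)`. -/
lemma hollowFrac_odd_ge (m : ℕ) : 3 / 4 + 1 / (4 * 4 ^ m) ≤ hollowFrac (2 * m + 1) m := by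
  induction m with
  | zero => simp [hollowFrac, hollowCount_zero]; norm_num
  | succ m ih =>
    rw [hollowFrac_odd_succ]
    have h1 : (1 : ℝ) ≤ 4 ^ m := one_le_pow₀ (by norm_num)
    have h2 : (1 : ℝ) / (8 * 4 ^ m) ≤ 1 := by
      rw [div_le_one (by positivity)]; linarith
    refine le_trans ?_ (mul_le_mul_of_nonneg_left ih (by linarith))
    rw [pow_succ]
    generalize (4 : ℝ) ^ m = y at *
    have hy : 0 < y := by linarith
    rw [← sub_nonneg]
    have : (1 - 1 / (8 * y)) * (3 / 4 + 1 / (4 * y)) - (3 / 4 + 1 / (4 * (y * 4))) =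
        (3 * y - 1) / (32 * y ^ 2) := by
      field_simp
      ring
    rw [this]
    exact div_nonneg (by linarith) (by positivity)

/-- Full rank `2m + 2` arises only by bordering a matrix of rank `2m` and size `2m + 1` with a
vector outside its range, which is exactly half of all vectors. -/
lemma hollowFrac_even_succ (m : ℕ) :
    hollowFrac (2 * m + 2) (m + 1) = hollowFrac (2 * m + 1) m / 2 := by
  have h := hollowCount_succ_add_two (2 * m + 1) (2 * m)
  rw [hollowCount_eq_zero_of_lt (by omega : 2 * m + 1 < 2 * m + 2), mul_zero, zero_add,
    pow_succ, mul_two, Nat.add_sub_cancel] at h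
  unfold hollowFrac
  rw [show 2 * (m + 1) = 2 * m + 2 by ring, show 2 * m + 2 = 2 * m + 1 + 1 by ring,
    Nat.triangle_succ, pow_add]
  rw [show 2 * m + 1 + 1 = 2 * m + 2 by ring, h, pow_succ 2 (2 * m)]
  push_cast
  field_simp

lemma sum_rank_mul_hollowFrac_le (n k : ℕ) :
    ∑ h ∈ Finset.range (k + 1), 2 * (h : ℝ) * hollowFrac n h ≤ 2 * k := by
  calc _ ≤ ∑ h ∈ Finset.range (k + 1), 2 * (k : ℝ) * hollowFrac n h := by
        refine Finset.sum_le_sum fun h hh => ?_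
        have : (h : ℝ) ≤ k := by exact_mod_cast Nat.lt_succ_iff.mp (Finset.mem_range.mp hh)
        have := hollowFrac_nonneg n h
        gcongr
    _ ≤ 2 * k := by
        rw [← Finset.mul_sum]
        exact mul_le_of_le_one_right (by positivity) (sum_hollowFrac_le_one n _)

lemma two_rpow_half_le {n : ℕ} :
    (2 : ℝ) ^ ((1 / 2 : ℝ) * ∑ h ∈ Finset.range (n / 2 + 1), 2 * (h : ℝ) * hollowFrac n h) ≤
      2 ^ (n / 2) := by
  rw [← Real.rpow_natCast]
  refine Real.rpow_le_rpow_of_exponent_le (by norm_num) ?_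
  linarith [sum_rank_mul_hollowFrac_le n (n / 2)]

lemma hollowFrac_mul_le_sum {n h : ℕ} (hh : h ≤ n / 2) :
    hollowFrac n h * 2 ^ (2 * h) ≤
      ∑ h ∈ Finset.range (n / 2 + 1), hollowFrac n h * 2 ^ (2 * h) :=
  Finset.single_le_sum (f := fun h => hollowFrac n h * 2 ^ (2 * h))
    (fun h _ => mul_nonneg (hollowFrac_nonneg n h) (by positivity))
    (Finset.mem_range.mpr (by omega))

lemma hollowCount_three_two : (hollowCount 3 2 : ℝ) = 7 := by
  rw [show 2 = 2 * 1 by rfl, hollowCount_eq_hollowFormula, hollowFormula]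
  norm_num [Finset.prod_range_succ]

lemma hollowCount_four_two : (hollowCount 4 2 : ℝ) = 35 := by
  rw [show 2 = 2 * 1 by rfl, hollowCount_eq_hollowFormula, hollowFormula]
  norm_num [Finset.prod_range_succ]

lemma hollowCount_four_four : (hollowCount 4 4 : ℝ) = 28 := by
  rw [show 4 = 2 * 2 by rfl, hollowCount_eq_hollowFormula, hollowFormula]
  norm_num [Finset.prod_range_succ, Finset.prod_Icc_succ_top]

/-! ### Comparing the closed forms with the two bounds -/

/-- Behind it is Cauchy–Schwarz, the squared mean of `2^(rank/2)` against the mean of `2^rank`. It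
reduces the theorem to the lower bound for `α = 1/2` and the upper bound for `α = 1`. -/
lemma secondMoment_half_le_one {x : ℝ} (hx : 2 ≤ x) :
    ((x ^ 3 + 2 * x ^ 2 - 1) / (2 * x ^ 2)) ^ 2 ≤ (x ^ 4 + 4 * x ^ 2 - 3) / (2 * x ^ 2) := by
  have hx0 : 0 < x := by linarith
  rw [← sub_nonneg]
  have h : (x ^ 4 + 4 * x ^ 2 - 3) / (2 * x ^ 2) - ((x ^ 3 + 2 * x ^ 2 - 1) / (2 * x ^ 2)) ^ 2 =
      ((x ^ 2 * (x - 2)) ^ 2 + (2 * x ^ 2 * (x - 2) + (2 * x ^ 2 - 1))) / (4 * x ^ 4) := by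
    field_simp
    ring
  rw [h]
  have h1 : 0 ≤ 2 * x ^ 2 * (x - 2) := mul_nonneg (by positivity) (by linarith)
  have h2 : 0 ≤ 2 * x ^ 2 - 1 := by nlinarith
  exact div_nonneg (by positivity) (by positivity)

lemma le_secondMoment_half {x : ℝ} (hx : 2 ≤ x) :
    x ≤ ((x ^ 3 + 2 * x ^ 2 - 1) / (2 * x ^ 2)) ^ 2 := by
  have hx0 : 0 < x := by linarith
  rw [← sub_nonneg]
  have h : ((x ^ 3 + 2 * x ^ 2 - 1) / (2 * x ^ 2)) ^ 2 - x =
      (x ^ 6 + 2 * x ^ 3 * (x - 2) + 2 * x ^ 3 + 2 * x ^ 2 * (x ^ 2 - 2) + 1) / (4 * x ^ 4) := by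
    field_simp
    ring
  rw [h]
  have h1 : 0 ≤ 2 * x ^ 3 * (x - 2) := mul_nonneg (by positivity) (by linarith)
  have h2 : 0 ≤ 2 * x ^ 2 * (x ^ 2 - 2) := mul_nonneg (by positivity) (by nlinarith)
  exact div_nonneg (by positivity) (by positivity)

lemma two_mul_le_secondMoment_half {x : ℝ} (hx : 4 ≤ x) :
    2 * x ≤ ((x ^ 3 + 2 * x ^ 2 - 1) / (2 * x ^ 2)) ^ 2 := by
  have h0 : x ^ 2 * 6 ≤ x ^ 3 + 2 * x ^ 2 := by nlinarith [sq_nonneg x]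
  have hx0 : 0 < x := by linarith
  rw [← sub_nonneg]
  have h : ((x ^ 3 + 2 * x ^ 2 - 1) / (2 * x ^ 2)) ^ 2 - 2 * x =
      (x ^ 4 * (x * (x - 4)) + 2 * x ^ 3 * (x - 1) + 2 * x ^ 2 * (x ^ 2 - 2) + 1) /
        (4 * x ^ 4) := by
    field_simp
    ring
  rw [h]
  have h1 : 0 ≤ 2 * x ^ 3 * (x - 1) := mul_nonneg (by positivity) (by linarith)
  have h2 : 0 ≤ 2 * x ^ 2 * (x ^ 2 - 2) := mul_nonneg (by positivity) (by nlinarith)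
  have h3 : 0 ≤ x ^ 4 * (x * (x - 4)) :=
    mul_nonneg (by positivity) (mul_nonneg hx0.le (by linarith))
  exact div_nonneg (by positivity) (by positivity)

lemma secondMoment_one_le {x : ℝ} (hx : 2 ≤ x) :
    (x ^ 4 + 4 * x ^ 2 - 3) / (2 * x ^ 2) ≤ (x ^ 2 + 4) / 2 := by
  have hx0 : 0 < x := by linarith
  rw [div_le_div_iff₀ (by positivity) (by norm_num)]
  nlinarith [sq_nonneg x]

lemma two_le_two_pow {n : ℕ} (hn : 3 ≤ n) : (2 : ℝ) ≤ 2 ^ ((n - 1) / 2) :=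
  le_self_pow₀ (by norm_num) (by omega)

lemma two_rpow_le_secondMoment {n : ℕ} (hn : 3 ≤ n) {x : ℝ} (hx : x = 2 ^ ((n - 1) / 2)) :
    (2 : ℝ) ^ ((1 / 2 : ℝ) * ∑ h ∈ Finset.range (n / 2 + 1), 2 * (h : ℝ) * hollowFrac n h) ≤
      ((x ^ 3 + 2 * x ^ 2 - 1) / (2 * x ^ 2)) ^ 2 := by
  have h2x : 2 ≤ x := hx ▸ two_le_two_pow hn
  rcases Nat.even_or_odd' n with ⟨m, hm | hm⟩
  · rcases eq_or_ne m 2 with rfl | hm2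
    -- For `n = 4` the crude bound `2^(n/2) = 4` exceeds the second moment `(15/8)^2`, so the
    -- average rank is computed exactly; half of `182/64` is below `3/2`.
    · subst hm
      have hx2 : x = 2 := by rw [hx]; norm_num
      have hsum : ∑ h ∈ Finset.range (2 * 2 / 2 + 1), 2 * (h : ℝ) * hollowFrac (2 * 2) h =
          182 / 64 := by
        norm_num [Finset.sum_range_succ, hollowFrac, hollowCount_four_two, hollowCount_four_four]
      have h3 : (2 : ℝ) ^ (3 / 2 : ℝ) ≤ 3 := by
        rw [show (3 / 2 : ℝ) = 3 * (1 / 2) by norm_num, Real.rpow_mul (by norm_num),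
          ← Real.sqrt_eq_rpow, Real.sqrt_le_left (by norm_num)]
        norm_num
      rw [hsum, hx2]
      calc _ ≤ (2 : ℝ) ^ (3 / 2 : ℝ) :=
            Real.rpow_le_rpow_of_exponent_le (by norm_num) (by norm_num)
        _ ≤ 3 := h3
        _ ≤ _ := by norm_num
    · have h4 : 4 ≤ x := by
        rw [hx, show (4 : ℝ) = 2 ^ 2 by norm_num]
        exact pow_le_pow_right₀ (by norm_num) (by omega)
      refine two_rpow_half_le.trans (le_trans (le_of_eq ?_) (two_mul_le_secondMoment_half h4))
      rw [hx, ← pow_succ']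
      congr 1
      omega
  · refine two_rpow_half_le.trans (le_trans (le_of_eq ?_) (le_secondMoment_half h2x))
    rw [hx]
    congr 1
    omega

lemma secondMoment_le_sum {n : ℕ} (hn : 3 ≤ n) {x : ℝ} (hx : x = 2 ^ ((n - 1) / 2)) :
    (x ^ 4 + 4 * x ^ 2 - 3) / (2 * x ^ 2) ≤
      ∑ h ∈ Finset.range (n / 2 + 1), hollowFrac n h * 2 ^ (2 * h) := by
  have h2x : 2 ≤ x := hx ▸ two_le_two_pow hn
  rcases Nat.even_or_odd' n with ⟨m, hm | hm⟩
  · refine (secondMoment_one_le h2x).trans (le_trans ?_ (hollowFrac_mul_le_sum (h := m) (by omega)))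
    obtain ⟨k, rfl⟩ : ∃ k, m = k + 1 := ⟨m - 1, by omega⟩
    subst hm
    have hr := hollowFrac_odd_ge k
    have hk : (0 : ℝ) < 1 / (4 * 4 ^ k) := by positivity
    -- Here `2^n = 4x²`, so the top term is at least `(3/4)/2 * 4x² = (3/2)x²`, which exceeds `(x² +
    -- 4)/2` already at `x = 2`.
    rw [show (2 * (k + 1) - 1) / 2 = k by omega] at hx
    rw [show 2 * (k + 1) = 2 * k + 2 by ring, hollowFrac_even_succ, pow_add, pow_mul', ← hx]
    nlinarith
  · subst hm
    rw [show (2 * m + 1 - 1) / 2 = m by omega] at hx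
    rcases eq_or_ne m 1 with rfl | hm1
    -- For `n = 3` both sides equal `29/8`, so no slack is available. For larger odd `n`, the top
    -- term is at least `(3/4)x²`, which suffices once `x ≥ 4`.
    · rw [hx]
      norm_num [Finset.sum_range_succ, hollowFrac, hollowCount_three_two, hollowCount_zero]
    · have h4 : 4 ≤ x := by
        rw [hx, show (4 : ℝ) = 2 ^ 2 by norm_num]
        exact pow_le_pow_right₀ (by norm_num) (by omega)
      refine (secondMoment_one_le h2x).trans
        (le_trans ?_ (hollowFrac_mul_le_sum (h := m) (by omega)))
      have hr := hollowFrac_odd_ge m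
      have hk : (0 : ℝ) < 1 / (4 * 4 ^ m) := by positivity
      rw [pow_mul', ← hx]
      nlinarith

theorem mainTheorem9 (n : ℕ) (hn : 3 ≤ n) (α : ℝ) (hα : α = 1 ∨ α = 1 / 2) :
    (∀ h : ℕ, (hollowCount n (2 * h) : ℝ) =
      (∏ i ∈ Finset.Icc 1 h, (2 : ℝ) ^ (2 * i - 2) / (2 ^ (2 * i) - 1)) *
        ∏ i ∈ Finset.range (2 * h), ((2 : ℝ) ^ ((n : ℤ) - (i : ℤ)) - 1)) ∧
    (∃ V : ℝ,
      IsGreatest {v : ℝ | ∃ ρ : Matrix (Fin n → ZMod 2) (Fin n → ZMod 2) ℂ,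
        IsDensityMatrix ρ ∧ v = dfeVariance α (completeState3 n) ρ} V ∧
      (2 : ℝ) ^ ((1 / 2 : ℝ) * ∑ h ∈ Finset.range (n / 2 + 1), 2 * (h : ℝ) * hollowFrac n h) ≤ V ∧
      V ≤ ∑ h ∈ Finset.range (n / 2 + 1), hollowFrac n h * 2 ^ (2 * h)) ∧
    (∀ ρ : Matrix (Fin n → ZMod 2) (Fin n → ZMod 2) ℂ, IsDensityMatrix ρ →
      (2 : ℝ) ^ ((1 / 2 : ℝ) * ∑ h ∈ Finset.range (n / 2 + 1), 2 * (h : ℝ) * hollowFrac n h) ≤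
          dfeVariance α (completeState3 n) ρ + expval (completeState3 n) ρ ^ 2 ∧
      dfeVariance α (completeState3 n) ρ + expval (completeState3 n) ρ ^ 2 ≤
          ∑ h ∈ Finset.range (n / 2 + 1), hollowFrac n h * 2 ^ (2 * h)) := by
  obtain ⟨x, hx⟩ : ∃ x : ℝ, x = 2 ^ ((n - 1) / 2) := ⟨_, rfl⟩
  have h2x : 2 ≤ x := hx ▸ two_le_two_pow hn
  have hS := dfeNorm_completeState3_ne_zero n hα
  have hbounds :
      (2 : ℝ) ^ ((1 / 2 : ℝ) * ∑ h ∈ Finset.range (n / 2 + 1), 2 * (h : ℝ) * hollowFrac n h) ≤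
        dfeSecondMoment α (completeState3 n) ∧
      dfeSecondMoment α (completeState3 n) ≤
        ∑ h ∈ Finset.range (n / 2 + 1), hollowFrac n h * 2 ^ (2 * h) := by
    have hlow := two_rpow_le_secondMoment hn hx
    have hmid := secondMoment_half_le_one h2x
    have hupp := secondMoment_le_sum hn hx
    rcases hα with rfl | rfl
    · rw [dfeSecondMoment_one_completeState3 hn hx]
      exact ⟨hlow.trans hmid, hupp⟩
    · rw [dfeSecondMoment_half_completeState3 hn hx]
      exact ⟨hlow, hmid.trans hupp⟩
  refine ⟨fun h => hollowCount_eq_hollowFormula n h,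
    ⟨dfeSecondMoment α (completeState3 n), ?_, hbounds⟩, fun ρ hρ => ?_⟩
  · rw [completeState3_eq] at hS ⊢
    exact isGreatest_dfeVariance (by omega) hS
  · rw [completeState3_eq] at hS hbounds ⊢
    rw [dfeVariance_add_sq hS hρ]
    exact hbounds
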